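/- **Setting.** Fix an infinite set of identifiers, a notion of valid sets of transactions together with the stake distribution resulting from executing such a set, and a finite index set of oracles. *Messages.* Messages, oracle responses and contents of queries are finite tuples of entries. An entry is of general type, of signed type $(id,a)$, of the type of an oracle $O$, or a transaction. At a given time, an entry is permitted for a player $p$ if it is general; or signed by some $id\in\mathtt{id}(p)$ or contained in a message that $p$ has received; or of type $O$ and contained in a message or response that $p$ has received; or a transaction contained in a message that $p$ has received. Players send only permitted messages and queries (all entries permitted). *Protocol.* A deterministic protocol is a triple $(\Sigma,\mathcal O,\mathcal C)$. The determined inputs are the delay bound $\Delta$, bounds $R^O_{\max}\ge 1$ for the permitters $O$, and the initial stake distribution $S_0$ (finitely supported, on identifiers); the duration is infinite. Each oracle is a response function, fixed by the determined inputs, taking a query and the timeslot $t$ of the query to a response and a delivery timeslot $t'\ge t$. Some oracles are permitters: a query to them devotes an amount $b$ of the resource to it, where $b\le\mathcal R^O(p,t)$ (multi-use), or where the amounts used by $p$ at $t$ sum to at most $\mathcal R^O(p,t)$ (single-use). $\Sigma$ is a (possibly infinite) state diagram with a set $St^*$ of resting states: the initial state, in $St^*$, depends on $\mathtt{id}(p)$,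 the protocol input in $\{0,1\}$ and the determined inputs; at each active timeslot $t$ the player moves to a state determined by its state, the multiset of messages received, $t$, and its own current resource balances; then it repeatedly receives the undelivered responses due by $t$ and, outside $St^*$, sends a set of queries and changes state (both determined by its state and these responses), until, in a state of $St^*$, it disseminates a finite set of messages determined likewise. If this does not stop, it disseminates nothing and is inactive afterwards. Ending a timeslot in certain states means having terminated with an output in $\{0,1\}$. The confirmation rule $\mathcal C$ maps a set of messages to a valid set of transactions among them. *Executions.* Timeslots are discrete, without end. There is an arbitrary set of players with disjoint non-empty identifier sets, each player with an input in $\{0,1\}$, an arbitrary set of them being Byzantine. At each timeslot a finite non-empty set of players is active. An environment may send finitely many transactions to each active player at each timeslot. Honest players follow $\Sigma$ at their active timeslots. Byzantine players can only crash or delay dissemination: a Byzantine player follows $\Sigma$ up to some timeslot (possibly for ever) and is idle afterwards, except that each message which $\Sigma$ instructed it to disseminate may be disseminated at any later timeslot at which it is active, or never. Communication is synchronous: a message disseminated by $p$ at $t$ is received by each other player at most once, after $t$, at an active timeslot, and by any timeslot $t'\ge t+\Delta$ at which that player is active; $p$ itself receives it at $t+1$, if active. The resource allocation gives natural numbers $\mathcal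 R^O(p,t)$, zero if $p$ is inactive at $t$. The adversary is *$\rho$-bounded* if for each permitter $O$ and each $t$ the total balance $\mathcal R^O(t)$ is in $[1,R^O_{\max}]$ and the Byzantine players hold at most $\rho\,\mathcal R^O(t)$ of it, and if for each honest player $p$ and each $t$, in the stake distribution given by $S_0$ and the transactions confirmed for $p$ at $t$, at most a $\rho$ fraction of the stake of the players active at $t$ belongs to Byzantine players. *Byzantine Agreement.* **Agreement**: all honest players that output give the same output. **Validity**: if all players have the same input $i$, every honest player that outputs gives output $i$. **Termination** (for $t^*$): all honest players active at some timeslot $\ge t^*$ terminate and give an output. A protocol *solves Byzantine Agreement* if every execution as above with $\rho$-bounded adversary, for all values $R^O_{\max}\geq 1$, satisfies the three conditions for some $t^*$. **Theorem.** Let $\rho>0$, $\Delta\ge 2$, let $S_0$ be any initial stake distribution, and consider any deterministic protocol. If the protocol satisfies Agreement and Validity in every execution as above with $\rho$-bounded adversary (for all values $R^O_{\max}\ge 1$), then for some values $R^O_{\max}\geq 1$ it has an infinite execution with $\rho$-bounded adversary in which honest players are active at every timeslot and no honest player ever terminates. In particular, no deterministic protocol solves Byzantine Agreement in this setting. -/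

import Mathlib

open scoped ENNReal

namespace Permissionless

universe u v w x y

/-! ### Messages, queries, inputs -/

/-- An entry of a message, with its type: general, signed (`signed i a` is `a` signed by the
identifier `i`), of the type of an oracle, or a transaction. -/
inductive Entry (Id : Type u) (Data : Type v) (Tx : Type w) (O : Type x) where
  | general (a : Data)
  | signed (i : Id) (a : Data)
  | oracle (o : O) (a : Data)
  | tx (a : Tx)

/-- Messages (and oracle responses) are finite tuples of entries. -/
abbrev Msg (Id : Type u) (Data : Type v) (Tx : Type w) (O : Type x) :=
  List (Entry Id Data Tx O)

/-- A query to `oracle`. For a permitter it is the pair `(amount, content)`, where `amount` is the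
part of the resource balance devoted to it; for other oracles `amount` has no special role. -/
structure Query (Id : Type u) (Data : Type v) (Tx : Type w) (O : Type x) where
  oracle : O
  amount : ℕ
  content : Msg Id Data Tx O

/-- The determined inputs, known to all players and oracles: the message delay bound, the bounds on
the total external resources, and the initial stake distribution. The duration is infinite. -/
structure Params (Id : Type u) (O : Type x) where
  delay : ℕ
  Rmax : O → ℕ
  stake₀ : Id →₀ ℕ

/-! ### Protocols -/

/-- The state diagram of honest players. `rest` is the set of states from which a player proceeds to
the next timeslot without further queries. A set of responses is a set of pairs (oracle, response).
* `start`: initial state, from the determined inputs, the player's identifiers and its protocol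
  input;
* `receive`: transition at the beginning of a timeslot, from the state, the messages received, the
  timeslot, and the player's own current resource balances;
* `query`: used in states outside `rest`: the queries to send and the next state, from the state and
  the responses just received;
* `disseminate`: used in states of `rest`: the messages to disseminate at the end of the timeslot;
* `output`: whether a player that ends a timeslot in this state has terminated, and its output. -/
structure StateDiagram (Id : Type u) (Data : Type v) (Tx : Type w) (O : Type x) where
  State : Type y
  rest : Set State
  start : Params Id O → Set Id → Bool → State
  start_mem : ∀ par ids b, start par ids b ∈ rest
  receive : State → Multiset (Msg Id Data Tx O) → ℕ → (O → ℕ) → State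
  query : State → Set (O × Msg Id Data Tx O) → Set (Query Id Data Tx O) × State
  disseminate : State → Set (O × Msg Id Data Tx O) → Finset (Msg Id Data Tx O)
  output : State → Option Bool

/-- Ordinary oracles, and the two kinds of permitters. -/
inductive OracleKind where
  | ordinary
  | singleUse
  | multiUse

/-- A deterministic oracle: the determined inputs fix the response function, which maps a query sent
at timeslot `t` to a response and a delivery timeslot `≥ t`. -/
structure Oracle (Id : Type u) (Data : Type v) (Tx : Type w) (O : Type x) where
  kind : OracleKind
  respond : Params Id O → ℕ × Msg Id Data Tx O → ℕ → Msg Id Data Tx O × ℕ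
  le_delivery : ∀ par q t, t ≤ (respond par q t).2

/-- The notion of validity for sets of transactions, and the stake distribution after the execution
of a set of transactions. No further property of them is needed. -/
structure PaymentSystem (Id : Type u) (Tx : Type w) where
  valid : (Id →₀ ℕ) → Set Tx → Prop
  stake : (Id →₀ ℕ) → Set Tx → (Id →₀ ℕ)
  valid_empty : ∀ S, valid S ∅
  stake_empty : ∀ S, stake S ∅ = S

/-- A deterministic protocol: a state diagram, oracles indexed by `O`, and a confirmation rule, which
selects a valid set of transactions among the messages of a set. -/
structure Protocol (Id : Type u) (Data : Type v) (Tx : Type w) (O : Type x)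
    (pay : PaymentSystem Id Tx) where
  diagram : StateDiagram.{u, v, w, x, y} Id Data Tx O
  oracle : O → Oracle Id Data Tx O
  confirm : (Id →₀ ℕ) → Set (Msg Id Data Tx O) → Set Tx
  confirm_subset : ∀ S M, confirm S M ⊆ {a | [Entry.tx a] ∈ M}
  confirm_valid : ∀ S M, pay.valid S (confirm S M)

variable {Id : Type u} {Data : Type v} {Tx : Type w} {O : Type x} {pay : PaymentSystem Id Tx}

/-! ### Timeslots of a single player -/

/-- What a player carries along. -/
structure LocalState (π : Protocol.{u, v, w, x, y} Id Data Tx O pay) where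
  state : π.diagram.State
  /-- responses (with oracle and delivery timeslot) to past queries, not yet received -/
  undelivered : Set (O × Msg Id Data Tx O × ℕ)
  /-- entries of the messages received so far -/
  heardMsg : Set (Entry Id Data Tx O)
  /-- entries of the responses received so far -/
  heardResp : Set (Entry Id Data Tx O)
  /-- resource balance already used in the current timeslot, for each oracle -/
  spent : O → ℝ≥0∞
  /-- the messages that the protocol instructed the player to disseminate, by timeslot -/
  log : ℕ → Finset (Msg Id Data Tx O)
  /-- the timeslots at which the instructions did not terminate -/
  stuckAt : Set ℕ

/-- Permitted entries in the authenticated setting, for a player with identifiers `ids` that has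
received the entries `hM` in messages and `hR` in responses. -/
def PermittedEntry (ids : Set Id) (hM hR : Set (Entry Id Data Tx O)) :
    Entry Id Data Tx O → Prop
  | .general _ => True
  | .signed i a => i ∈ ids ∨ Entry.signed i a ∈ hM
  | .oracle o a => Entry.oracle o a ∈ hM ∨ Entry.oracle o a ∈ hR
  | .tx a => Entry.tx a ∈ hM

/-- A message or query content is permitted if all its entries are. -/
def PermittedMsg (ids : Set Id) (hM hR : Set (Entry Id Data Tx O)) (m : Msg Id Data Tx O) : Prop :=
  ∀ e ∈ m, PermittedEntry ids hM hR e

section Slot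

variable (π : Protocol.{u, v, w, x, y} Id Data Tx O pay) (par : Params Id O)
  (ids : Set Id) (bal : O → ℕ) (t : ℕ)

/-- The undelivered responses with delivery timeslot `≤ t`. -/
def LocalState.due {π : Protocol.{u, v, w, x, y} Id Data Tx O pay} (L : LocalState π) (t : ℕ) :
    Set (O × Msg Id Data Tx O) :=
  {r | ∃ t' ≤ t, (r.1, r.2, t') ∈ L.undelivered}

/-- The due responses are received. -/
def LocalState.collect {π : Protocol.{u, v, w, x, y} Id Data Tx O pay} (L : LocalState π) (t : ℕ) :
    LocalState π :=
  { L with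
    undelivered := {r ∈ L.undelivered | t < r.2.2}
    heardResp := L.heardResp ∪ {e | ∃ r ∈ L.due t, e ∈ r.2} }

/-- The queries actually sent when the state diagram specifies the set `Q`: those that are permitted
and respect the resource balances. If the permitted queries in `Q` to a single-use permitter exceed
together what is left of the balance in this timeslot, then none of them is sent. -/
def sentQueries (L : LocalState π) (Q : Set (Query Id Data Tx O)) : Set (Query Id Data Tx O) :=
  {q ∈ Q | PermittedMsg ids L.heardMsg L.heardResp q.content ∧
    match (π.oracle q.oracle).kind with
    | .ordinary => True
    | .multiUse => q.amount ≤ bal q.oracle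
    | .singleUse =>
        L.spent q.oracle + ∑' q' : {q' : Query Id Data Tx O // q' ∈ Q ∧ q'.oracle = q.oracle ∧
          PermittedMsg ids L.heardMsg L.heardResp q'.content}, (q'.1.amount : ℝ≥0∞)
        ≤ (bal q.oracle : ℝ≥0∞)}

open Classical in
/-- One iteration within a timeslot: in a state outside `rest`, the player receives the due
responses, sends queries and changes its state. -/
noncomputable def iterStep (L : LocalState π) : LocalState π :=
  if L.state ∈ π.diagram.rest then L else
    let R := L.due t
    let L₁ := L.collect t
    let Q := sentQueries π ids bal L₁ (π.diagram.query L.state R).1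
    { L₁ with
      state := (π.diagram.query L.state R).2
      undelivered := L₁.undelivered ∪
        {r | ∃ q ∈ Q, r = (q.oracle, (π.oracle q.oracle).respond par (q.amount, q.content) t)}
      spent := fun o => L₁.spent o + ∑' q : {q // q ∈ Q ∧ q.oracle = o}, (q.1.amount : ℝ≥0∞) }

/-- The situation of a player after receiving the multiset `M` of messages at timeslot `t`. -/
def beginSlot (M : Multiset (Msg Id Data Tx O)) (L : LocalState π) : LocalState π :=
  { L with
    state := π.diagram.receive L.state M t bal
    heardMsg := L.heardMsg ∪ {e | ∃ m ∈ M, e ∈ m}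
    spent := fun _ => 0 }

open Classical in
/-- The end of a timeslot, in a state of `rest`: the player receives the due responses, and the
permitted messages specified by the state diagram are recorded for dissemination. -/
noncomputable def endSlot (L : LocalState π) : LocalState π :=
  let L₁ := L.collect t
  { L₁ with
    log := Function.update L.log t
      ((π.diagram.disseminate L.state (L.due t)).filter
        (PermittedMsg ids L₁.heardMsg L₁.heardResp)) }

open Classical in
/-- The instructions of a player at an active timeslot. If they do not terminate, this is
recorded. -/
noncomputable def runSlot (M : Multiset (Msg Id Data Tx O)) (L : LocalState π) : LocalState π :=
  if h : ∃ n, ((iterStep π par ids bal t)^[n] (beginSlot π bal t M L)).state ∈ π.diagram.rest then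
    endSlot π ids t ((iterStep π par ids bal t)^[Nat.find h] (beginSlot π bal t M L))
  else { L with stuckAt := insert t L.stuckAt }

end Slot

/-! ### Executions -/

/-- The data that determine an execution with player set `P` of a deterministic protocol whose faulty
players can only crash or delay the dissemination of messages. Timeslots are numbered from `0`.

Every player `p` follows the state diagram at its active timeslots before `halt p` and is idle
afterwards, except that it may still disseminate delayed messages. A message `m` that the diagram
tells `p` to disseminate at `t` is disseminated at timeslot `release p t m` (never, if that is `⊤`, or
if `p` is not active then). Honest players have `halt p = ⊤` and `release p t m = t`; a crash at
`t` is `halt p ≤ t + 1` and `release = ⊤` for the messages not yet disseminated.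

A message disseminated by `p` at `t` is received by `q` at timeslot `timing p q m t`. -/
structure Execution (Id : Type u) (Data : Type v) (Tx : Type w) (O : Type x) (P : Type) where
  ids : P → Set Id
  input : P → Bool
  allocated : ℕ → Finset P
  byzantine : Set P
  balance : O → P → ℕ → ℕ
  halt : P → ℕ∞
  release : P → ℕ → Msg Id Data Tx O → ℕ∞
  timing : P → P → Msg Id Data Tx O → ℕ → Option ℕ
  /-- the transactions sent by the environment to a player at a timeslot -/
  env : P → ℕ → Finset Tx

namespace Execution

variable {P : Type} (E : Execution Id Data Tx O P)

/-! In the next three definitions, `g` describes the players at the beginning of some timeslot, late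
enough to contain what happened at the timeslots in question. -/

/-- Player `p` is active at `t`: it is allocated to `t`, and all its instructions at earlier timeslots
terminated. -/
def activeIn {π : Protocol.{u, v, w, x, y} Id Data Tx O pay} (g : P → LocalState π)
    (t : ℕ) (p : P) : Prop :=
  p ∈ E.allocated t ∧ ∀ t₀ < t, t₀ ∉ (g p).stuckAt

open Classical in
/-- The messages disseminated by `p` at `t`. -/
noncomputable def disseminatedIn {π : Protocol.{u, v, w, x, y} Id Data Tx O pay}
    (g : P → LocalState π) (p : P) (t : ℕ) : Finset (Msg Id Data Tx O) :=
  if E.activeIn g t p ∧ t ∉ (g p).stuckAt then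
    (Finset.range (t + 1)).biUnion fun t₀ => ((g p).log t₀).filter fun m => E.release p t₀ m = t
  else ∅

open Classical in
/-- The multiset of messages received by `q` at `t`, from players and from the environment. -/
noncomputable def receivedIn {π : Protocol.{u, v, w, x, y} Id Data Tx O pay}
    (g : P → LocalState π) (q : P) (t : ℕ) : Multiset (Msg Id Data Tx O) :=
  if E.activeIn g t q then
    (∑ t₀ ∈ Finset.range t, ∑ p ∈ E.allocated t₀,
      ((E.disseminatedIn g p t₀).filter fun m => E.timing p q m t₀ = some t).val)
    + (E.env q t).val.map fun a => [Entry.tx a]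
  else 0

variable (π : Protocol.{u, v, w, x, y} Id Data Tx O pay) (par : Params Id O)

open Classical in
/-- The situation of every player at the beginning of every timeslot. -/
noncomputable def history : ℕ → P → LocalState π
  | 0 => fun p =>
    { state := π.diagram.start par (E.ids p) (E.input p)
      undelivered := ∅
      heardMsg := ∅
      heardResp := ∅
      spent := fun _ => 0
      log := fun _ => ∅
      stuckAt := ∅ }
  | t + 1 => fun p =>
    if E.activeIn (history t) t p ∧ (t : ℕ∞) < E.halt p then
      runSlot π par (E.ids p) (fun o => E.balance o p t) t
        (E.receivedIn (history t) p t) (history t p)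
    else history t p

/-- Player `p` is active at timeslot `t`. -/
def Active (t : ℕ) (p : P) : Prop := E.activeIn (E.history π par t) t p

/-- The messages disseminated by `p` at timeslot `t`. -/
noncomputable def disseminated (p : P) (t : ℕ) : Finset (Msg Id Data Tx O) :=
  E.disseminatedIn (E.history π par (t + 1)) p t

/-- The messages received by `p` at timeslot `t`. -/
noncomputable def received (p : P) (t : ℕ) : Multiset (Msg Id Data Tx O) :=
  E.receivedIn (E.history π par t) p t

/-- Player `p` completes timeslot `t` in a state in which it has terminated with output `b`. -/
def OutputsAt (p : P) (t : ℕ) (b : Bool) : Prop :=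
  E.Active π par t p ∧ (t : ℕ∞) < E.halt p ∧ t ∉ (E.history π par (t + 1) p).stuckAt ∧
    π.diagram.output (E.history π par (t + 1) p).state = some b

/-- Synchronous communication: what `p` disseminates at `t` has been received by another player `q` by
any timeslot `t' ≥ t + Δ` at which `q` is active. A player receives its own
disseminations one timeslot later, if active. -/
def Synchronous : Prop :=
  (∀ p q m t r, E.timing p q m t = some r → t < r) ∧
  (∀ p m t, E.timing p p m t = some (t + 1)) ∧
  ∀ p q m t t', p ≠ q → m ∈ E.disseminated π par p t → t + par.delay ≤ t' →
    E.Active π par t' q → ∃ r ≤ t', E.timing p q m t = some r ∧ E.Active π par r q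

/-- The executions consistent with the fully permissionless, authenticated and synchronous setting,
with faulty players that only crash or delay dissemination. -/
structure Consistent : Prop where
  ids_nonempty : ∀ p, (E.ids p).Nonempty
  ids_disjoint : Pairwise fun p q => Disjoint (E.ids p) (E.ids q)
  exists_active : ∀ t, ∃ p, E.Active π par t p
  honest_halt : ∀ p ∉ E.byzantine, E.halt p = ⊤
  honest_release : ∀ p ∉ E.byzantine, ∀ (t : ℕ) m, E.release p t m = t
  le_release : ∀ p (t : ℕ) m, (t : ℕ∞) ≤ E.release p t m
  synchronous : E.Synchronous π par
  env_active : ∀ p t, (E.env p t).Nonempty → E.Active π par t p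
  balance_inactive : ∀ o p t, ¬ E.Active π par t p → E.balance o p t = 0
  balance_ordinary : ∀ o p t, (π.oracle o).kind = .ordinary → E.balance o p t = 0

open Classical in
/-- The resource allocation of `o` is `ρ`-bounded. Inactive players have balance `0`, so the totals
are sums over the players allocated to the timeslot. -/
def ResourceBounded (ρ : ℝ) (o : O) : Prop :=
  ∀ t, 1 ≤ ∑ p ∈ E.allocated t, E.balance o p t ∧
    ∑ p ∈ E.allocated t, E.balance o p t ≤ par.Rmax o ∧
    ((∑ p ∈ (E.allocated t).filter (· ∈ E.byzantine), E.balance o p t : ℕ) : ℝ) ≤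
      ρ * ((∑ p ∈ E.allocated t, E.balance o p t : ℕ) : ℝ)

/-- The transactions confirmed for `p` at `t`. -/
def confirmed (p : P) (t : ℕ) : Set Tx :=
  π.confirm par.stake₀ {m | ∃ t' ≤ t, m ∈ E.received π par p t'}

open Classical in
/-- The stake that the distribution `S` allocates to those players active at `t` that lie in `A`. -/
noncomputable def activeStake (S : Id →₀ ℕ) (A : Set P) (t : ℕ) : ℕ :=
  ∑ i ∈ S.support.filter (fun i => ∃ p ∈ A, E.Active π par t p ∧ i ∈ E.ids p), S i

/-- The adversary is `ρ`-bounded. -/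
structure Bounded (ρ : ℝ) : Prop where
  resource : ∀ o, (π.oracle o).kind ≠ .ordinary → E.ResourceBounded par ρ o
  stake : ∀ p ∉ E.byzantine, ∀ t,
    (E.activeStake π par (pay.stake par.stake₀ (E.confirmed π par p t)) E.byzantine t : ℝ) ≤
      ρ * (E.activeStake π par (pay.stake par.stake₀ (E.confirmed π par p t)) Set.univ t : ℝ)

/-- All honest players active at any timeslot `≥ t'` terminate and give an output. -/
def Termination (t' : ℕ) : Prop :=
  ∀ p ∉ E.byzantine, (∃ t ≥ t', E.Active π par t p) → ∃ t b, E.OutputsAt π par p t b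

/-- All honest players that output give the same output. -/
def Agreement : Prop :=
  ∀ p ∉ E.byzantine, ∀ q ∉ E.byzantine, ∀ t₁ t₂ b₁ b₂,
    E.OutputsAt π par p t₁ b₁ → E.OutputsAt π par q t₂ b₂ → b₁ = b₂

/-- If all players have the same input, then every honest player that outputs gives that output. -/
def Validity : Prop :=
  ∀ b, (∀ p, E.input p = b) → ∀ p ∉ E.byzantine, ∀ t b', E.OutputsAt π par p t b' → b' = b

end Execution

/-! ### Byzantine Agreement -/

section BA

variable (π : Protocol.{u, v, w, x, y} Id Data Tx O pay) (ρ : ℝ) (Δ : ℕ) (S₀ : Id →₀ ℕ)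

/-- With message delay bound `Δ` and initial stake `S₀`, for all values `≥ 1` of the resource bounds,
the property `F` holds in all consistent executions with a `ρ`-bounded adversary. -/
def Ensures (F : ∀ (P : Type), Params Id O → Execution Id Data Tx O P → Prop) : Prop :=
  ∀ Rmax : O → ℕ, (∀ o, 1 ≤ Rmax o) → ∀ (P : Type) (E : Execution Id Data Tx O P),
    E.Consistent π ⟨Δ, Rmax, S₀⟩ → E.Bounded π ⟨Δ, Rmax, S₀⟩ ρ → F P ⟨Δ, Rmax, S₀⟩ E

/-- The protocol never violates agreement or validity. -/
def SafeBA : Prop :=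
  Ensures π ρ Δ S₀ fun _ par E => E.Agreement π par ∧ E.Validity π par

/-- The protocol solves Byzantine Agreement. -/
def SolvesBA : Prop :=
  Ensures π ρ Δ S₀ fun _ par E =>
    ∃ t', E.Termination π par t' ∧ E.Agreement π par ∧ E.Validity π par

/-- Some execution of the protocol (they are all infinite), in which honest players are active at all
timeslots, has no honest player that ever terminates. -/
def HasNonterminatingExecution : Prop :=
  ∃ Rmax : O → ℕ, (∀ o, 1 ≤ Rmax o) ∧ ∃ (P : Type) (E : Execution Id Data Tx O P),
    E.Consistent π ⟨Δ, Rmax, S₀⟩ ∧ E.Bounded π ⟨Δ, Rmax, S₀⟩ ρ ∧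
    (∀ t, ∃ p ∉ E.byzantine, E.Active π ⟨Δ, Rmax, S₀⟩ t p) ∧
    ∀ p ∉ E.byzantine, ∀ t b, ¬ E.OutputsAt π ⟨Δ, Rmax, S₀⟩ p t b

end BA

end Permissionless

/-! This is a bivalence argument. Every timeslot gets a fresh group of `k` players, where `k ≥ 2`
and `ρ * k ≥ 1`; each acts at that timeslot only and holds one unit of every permitter's resource.
At most one player per group is late, that is, Byzantine: it follows the protocol, but its messages
come out later or never. The Byzantine players thus hold at most one unit out of `k`. No identifier
carries stake and no transaction ever circulates, so the stake bound reads `0 ≤ 0`. As a player runs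
only once, its messages and output are a function of its input and its inbox, and an execution
reduces to a combinatorial `Schedule`.

Suppose that every valid schedule led to a decision. Inputs are revealed group by group, so by
Validity the empty prefix is bivalent. The crux is `Univalent.decides_eq`: if every extension of a
prefix by one timeslot `T` fixes the decision, all of them fix the same one. Two moves link the
extensions. By `Extends.decides_withhold`, it does not matter whether the messages of a player come
out at `T` or later: as `Δ ≥ 2`, a message released at `T` may be first heard at `T + 2`, exactly
like one released at `T + 1`. By `Extends.decides_change`, the input and inbox of a player that is
never heard are irrelevant. Now release all pending messages at `T`, then treat the players of group
`T` one at a time: silence, change, restore. At most one of them is late at any moment.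

Hence bivalent prefixes extend forever (`Bivalent.exists_succ`). In the limit schedule no honest
player outputs, since an output is fixed by a finite prefix (`exists_valid_undecided`). The rest of
the proof shows that valid schedules are genuine executions with bounded adversary. -/

namespace Permissionless

/-! ### Schedules

Players are pairs `(t, i)`; the players `(t, i)` with `i : Fin k` form the group that acts at
timeslot `t`. -/

/-- What the adversary chooses: inputs, the timeslots at which the messages of the players are
released, and, for each player, the players whose messages it receives before acting. -/
structure Schedule (k : ℕ) where
  input : ℕ × Fin k → Bool
  release : ℕ × Fin k → ℕ∞
  hears : ℕ × Fin k → Set (ℕ × Fin k)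

namespace Schedule

variable {k : ℕ}

/-- A player is late if its messages are released after the timeslot at which it acts. -/
def Late (R : Schedule k) (p : ℕ × Fin k) : Prop := R.release p ≠ p.1

/-- The constraints on the part of a schedule that concerns the timeslots before `T`. -/
structure ValidUpTo (R : Schedule k) (T : ℕ) : Prop where
  le_release : ∀ p, p.1 < T → (p.1 : ℕ∞) ≤ R.release p
  late_unique : ∀ p q, p.1 < T → p.1 = q.1 → R.Late p → R.Late q → p = q
  released : ∀ q p, q.1 < T → p ∈ R.hears q → p.1 < q.1 ∧ R.release p < q.1
  -- The gap of 2 is the slack given by `Δ ≥ 2`: a message released one timeslot before `q` acts may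
  -- be heard by `q` or not.
  hears : ∀ q p, q.1 < T → p.1 < q.1 → R.release p + 2 ≤ q.1 → p ∈ R.hears q

def Valid (R : Schedule k) : Prop := ∀ T, R.ValidUpTo T

/-- The schedules agree on what happens before `T`. -/
structure SameUpTo (T : ℕ) (R R' : Schedule k) : Prop where
  input : ∀ p, p.1 < T → R.input p = R'.input p
  hears : ∀ p, p.1 < T → R.hears p = R'.hears p
  -- A release at `T` or later is not yet visible, so two such dates need not coincide.
  release : ∀ p, p.1 < T → (R.release p < T ∨ R'.release p < T) → R.release p = R'.release p

lemma SameUpTo.refl (T : ℕ) (R : Schedule k) : SameUpTo T R R :=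
  ⟨fun _ _ => rfl, fun _ _ => rfl, fun _ _ _ => rfl⟩

lemma SameUpTo.symm {T : ℕ} {R R' : Schedule k} (h : SameUpTo T R R') : SameUpTo T R' R :=
  ⟨fun p hp => (h.input p hp).symm, fun p hp => (h.hears p hp).symm,
    fun p hp hr => (h.release p hp hr.symm).symm⟩

lemma SameUpTo.trans {T : ℕ} {R R' R'' : Schedule k} (h : SameUpTo T R R')
    (h' : SameUpTo T R' R'') : SameUpTo T R R'' := by
  refine ⟨fun p hp => (h.input p hp).trans (h'.input p hp),
    fun p hp => (h.hears p hp).trans (h'.hears p hp), fun p hp hr => ?_⟩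
  have h1 := h.release p hp
  have h2 := h'.release p hp
  rcases hr with hr | hr
  · have e := h1 (Or.inl hr)
    exact e.trans (h2 (Or.inl (e ▸ hr)))
  · have e := h2 (Or.inr hr)
    exact (h1 (Or.inr (e ▸ hr))).trans e

lemma SameUpTo.mono {S T : ℕ} {R R' : Schedule k} (h : SameUpTo T R R') (hST : S ≤ T) :
    SameUpTo S R R' := by
  have hc : (S : ℕ∞) ≤ T := by exact_mod_cast hST
  exact ⟨fun p hp => h.input p (hp.trans_le hST), fun p hp => h.hears p (hp.trans_le hST),
    fun p hp hr => h.release p (hp.trans_le hST)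
      (hr.imp (fun h => h.trans_le hc) (fun h => h.trans_le hc))⟩

lemma SameUpTo.zero (R R' : Schedule k) : SameUpTo 0 R R' :=
  ⟨fun _ h => absurd h (Nat.not_lt_zero _), fun _ h => absurd h (Nat.not_lt_zero _),
    fun _ h => absurd h (Nat.not_lt_zero _)⟩

lemma SameUpTo.late_iff {T : ℕ} {R R' : Schedule k} (h : SameUpTo T R R') {p : ℕ × Fin k}
    (hp : p.1 < T) : R.Late p ↔ R'.Late p := by
  have h1 := h.release p hp
  have hc : (p.1 : ℕ∞) < T := by exact_mod_cast hp
  refine not_congr ⟨fun e => ?_, fun e => ?_⟩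
  · rw [← h1 (Or.inl (e ▸ hc)), e]
  · rw [h1 (Or.inr (e ▸ hc)), e]

/-- Each clause of validity before `T` depends only on release dates before `T`, which are common to
both schedules. -/
lemma SameUpTo.validUpTo {T : ℕ} {R R' : Schedule k} (h : SameUpTo T R R')
    (hR : R.ValidUpTo T) : R'.ValidUpTo T := by
  refine ⟨fun p hp => ?_, fun p q hp hpq h1 h2 => ?_, fun q p hq hpq => ?_,
    fun q p hq hpq hr => ?_⟩
  · have h1 := h.release p hp
    have h2 := hR.le_release p hp
    by_contra hcon
    have hc : (p.1 : ℕ∞) < T := by exact_mod_cast hp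
    rw [h1 (Or.inr ((not_le.1 hcon).trans hc))] at h2
    exact hcon h2
  · exact hR.late_unique p q hp hpq ((h.late_iff hp).2 h1) ((h.late_iff (hpq ▸ hp)).2 h2)
  · rw [← h.hears q hq] at hpq
    obtain ⟨h1, h2⟩ := hR.released q p hq hpq
    have hc : (q.1 : ℕ∞) < T := by exact_mod_cast hq
    rw [← h.release p (h1.trans hq) (Or.inl (h2.trans hc))]
    exact ⟨h1, h2⟩
  · rw [← h.hears q hq]
    have hc : (q.1 : ℕ∞) < T := by exact_mod_cast hq
    have h2 : R'.release p < T := (le_self_add.trans hr).trans_lt hc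
    rw [← h.release p (hpq.trans hq) (Or.inr h2)] at hr
    exact hR.hears q p hq hpq hr

open Classical in
/-- Continue a schedule from `T` on without faults and with delivery as late as possible; messages
withheld so far are never released. -/
noncomputable def lazy (T : ℕ) (R : Schedule k) : Schedule k where
  input p := if p.1 < T then R.input p else false
  release p := if p.1 < T then (if R.release p < T then R.release p else ⊤) else p.1
  hears q := if q.1 < T then R.hears q else
    {p | p.1 < q.1 ∧
      (if p.1 < T then (if R.release p < T then R.release p else ⊤) else (p.1 : ℕ∞)) + 2 ≤ q.1}

lemma sameUpTo_lazy (T : ℕ) (R : Schedule k) : SameUpTo T R (R.lazy T) := by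
  refine ⟨fun p hp => by simp [lazy, hp], fun p hp => by simp [lazy, hp], fun p hp hr => ?_⟩
  by_cases h : R.release p < T
  · simp [lazy, hp, h]
  · simp [lazy, hp, h] at hr

lemma hears_lazy {T : ℕ} {R : Schedule k} {q : ℕ × Fin k} (hq : T ≤ q.1) :
    (R.lazy T).hears q = {p | p.1 < q.1 ∧ (R.lazy T).release p + 2 ≤ q.1} := by
  simp [lazy, hq.not_gt]

lemma release_lazy_of_le {T : ℕ} {R : Schedule k} {p : ℕ × Fin k} (hp : T ≤ p.1) :
    (R.lazy T).release p = p.1 := by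
  simp [lazy, hp.not_gt]

lemma release_lazy_of_lt {T : ℕ} {R : Schedule k} {p : ℕ × Fin k} (h : p.1 < T)
    (hp : R.release p < T) : (R.lazy T).release p = R.release p := by
  simp [lazy, hp, h]

lemma release_lazy_eq_top {T : ℕ} {R : Schedule k} {p : ℕ × Fin k} (h : p.1 < T)
    (hp : T ≤ R.release p) : (R.lazy T).release p = ⊤ := by
  simp [lazy, hp.not_gt, h]

lemma ValidUpTo.valid_lazy {T : ℕ} {R : Schedule k} (h : R.ValidUpTo T) : (R.lazy T).Valid := by
  have h' := (sameUpTo_lazy T R).validUpTo h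
  refine fun S => ⟨fun p _ => ?_, fun p q _ hpq h1 h2 => ?_, fun q p _ hp => ?_,
    fun q p _ hp hr => ?_⟩
  · by_cases hp : p.1 < T
    · exact h'.le_release p hp
    · exact (release_lazy_of_le (not_lt.1 hp)).ge
  · by_cases hp : p.1 < T
    · exact h'.late_unique p q hp hpq h1 h2
    · exact absurd (release_lazy_of_le (not_lt.1 hp)) h1
  · by_cases hq : q.1 < T
    · exact h'.released q p hq hp
    · rw [hears_lazy (not_lt.1 hq)] at hp
      refine ⟨hp.1, ?_⟩
      have hp2 := hp.2
      generalize (R.lazy T).release p = r at hp2 ⊢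
      enat_to_nat
      omega
  · by_cases hq : q.1 < T
    · exact h'.hears q p hq hp hr
    · rw [hears_lazy (not_lt.1 hq)]
      exact ⟨hp, hr⟩

/-! ### Behaviour of the players under a schedule -/

variable {M : Type*} (F : ℕ × Fin k → Bool → Multiset M → Finset M × Option Bool)

open Classical in
/-- The messages and the output of the player `(t, i)`, if `F` gives these as a function of the
player, its input and the messages received. -/
noncomputable def behaviour (R : Schedule k) : (t : ℕ) → (i : Fin k) → Finset M × Option Bool
  | t, i => F (t, i) (R.input (t, i)) (∑ u : Fin t, ∑ j : Fin k,
      if (u.1, j) ∈ R.hears (t, i) then (behaviour R u.1 j).1.val else 0)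
termination_by t => t
decreasing_by exact u.2

/-- The set `A` is closed under hearing, so the recursion that defines the behaviour of its members
never leaves it. -/
lemma behaviour_congr {R R' : Schedule k} (A : Set (ℕ × Fin k))
    (hi : ∀ p ∈ A, R.input p = R'.input p) (hh : ∀ p ∈ A, R.hears p = R'.hears p)
    (hA : ∀ q ∈ A, ∀ p ∈ R.hears q, p.1 < q.1 → p ∈ A) :
    ∀ p ∈ A, R.behaviour F p.1 p.2 = R'.behaviour F p.1 p.2 := by
  suffices H : ∀ t i, (t, i) ∈ A → R.behaviour F t i = R'.behaviour F t i from
    fun p hp => H p.1 p.2 hp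
  intro t
  induction t using Nat.strong_induction_on with
  | _ t ih =>
    intro i hti
    rw [behaviour, behaviour, hi _ hti]
    congr 1
    refine Finset.sum_congr rfl fun u _ => Finset.sum_congr rfl fun j _ => ?_
    rw [← hh _ hti]
    split_ifs with hj
    · rw [ih u.1 u.2 j (hA _ hti _ hj u.2)]
    · rfl

/-- Some player that is not late outputs `b`. -/
def Decides (R : Schedule k) (b : Bool) : Prop :=
  ∃ p, ¬ R.Late p ∧ (R.behaviour F p.1 p.2).2 = some b

lemma SameUpTo.behaviour_eq {T : ℕ} {R R' : Schedule k} (h : SameUpTo T R R')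
    {p : ℕ × Fin k} (hp : p.1 < T) : R.behaviour F p.1 p.2 = R'.behaviour F p.1 p.2 :=
  behaviour_congr F {p | p.1 < T} h.input h.hears
    (fun _ hq _ _ hpq => lt_trans hpq hq) p hp

end Schedule

/-! ### Invariance of the decision under the choices of one timeslot. -/

/-- A schedule always leads to exactly one decision. -/
structure Decisive {k : ℕ} {M : Type*}
    (F : ℕ × Fin k → Bool → Multiset M → Finset M × Option Bool) : Prop where
  exists_decides : ∀ R : Schedule k, R.Valid → ∃ b, R.Decides F b
  unique : ∀ R : Schedule k, R.Valid → ∀ b b', R.Decides F b → R.Decides F b' → b = b'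

namespace Schedule

variable {k : ℕ} {M : Type*} {F : ℕ × Fin k → Bool → Multiset M → Finset M × Option Bool}

/-- One inclusion suffices: `R'` decides something, `R` then decides it too, and decisions are
unique. -/
lemma decides_eq_of_subset (hF : Decisive F) {R R' : Schedule k} (hR : R.Valid) (hR' : R'.Valid)
    (h : ∀ p, ¬ R'.Late p → ¬ R.Late p ∧ R.behaviour F p.1 p.2 = R'.behaviour F p.1 p.2) :
    R.Decides F = R'.Decides F := by
  have key : ∀ b, R'.Decides F b → R.Decides F b := by
    rintro b ⟨p, hp, hb⟩
    exact ⟨p, (h p hp).1, (h p hp).2 ▸ hb⟩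
  funext b
  refine propext ⟨fun hb => ?_, key b⟩
  obtain ⟨b', hb'⟩ := hF.exists_decides R' hR'
  rwa [hF.unique R hR b b' hb (key _ hb')]

/-- The decision is the same for all schedules that agree up to `T` with `R` and up to `T + 1` with
each other. -/
def Univalent (F : ℕ × Fin k → Bool → Multiset M → Finset M × Option Bool)
    (T : ℕ) (R₀ : Schedule k) : Prop :=
  ∀ R R' : Schedule k, R.Valid → R'.Valid → SameUpTo T R₀ R → SameUpTo (T + 1) R R' →
    R.Decides F = R'.Decides F

/-- Valid prefixes of length `T + 1` that extend the prefix of length `T` of `R₀`. -/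
structure Extends (T : ℕ) (R₀ R : Schedule k) : Prop where
  valid : R.ValidUpTo (T + 1)
  same : SameUpTo T R₀ R

/-- Under univalence, the lazy continuation can stand for all continuations of a prefix of length `T
+ 1`. -/
lemma Extends.decides_eq {T : ℕ} {R₀ R R' : Schedule k} (hU : Univalent F T R₀)
    (hR : Extends T R₀ R) (h : SameUpTo (T + 1) R R') (hR' : R'.Valid) :
    (R.lazy (T + 1)).Decides F = R'.Decides F :=
  hU _ _ hR.valid.valid_lazy hR' (hR.same.trans ((sameUpTo_lazy _ R).mono T.le_succ))
    ((sameUpTo_lazy _ R).symm.trans h)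

lemma Extends.of_sameUpTo {T : ℕ} {R₀ R R' : Schedule k}
    (hR : Extends T R₀ R) (h : SameUpTo (T + 1) R R') : Extends T R₀ R' :=
  ⟨h.validUpTo hR.valid, hR.same.trans (h.mono T.le_succ)⟩

lemma Extends.decides_eq' {T : ℕ} {R₀ R R' : Schedule k} (hU : Univalent F T R₀)
    (hR : Extends T R₀ R) (h : SameUpTo (T + 1) R R') :
    (R.lazy (T + 1)).Decides F = (R'.lazy (T + 1)).Decides F :=
  hR.decides_eq hU (h.trans (sameUpTo_lazy _ _)) (hR.of_sameUpTo h).valid.valid_lazy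

/-- Withholding the messages of `p` beyond `T` does not affect the decision. -/
lemma Extends.decides_withhold (hF : Decisive F) {T : ℕ} {R₀ R R' : Schedule k}
    (hU : Univalent F T R₀) (hR : Extends T R₀ R) (hR' : Extends T R₀ R') {p : ℕ × Fin k}
    (hpT : p.1 ≤ T) (hp : R.release p = T) (hp' : T < R'.release p)
    (hi : ∀ q, q.1 ≤ T → R.input q = R'.input q) (hh : ∀ q, q.1 ≤ T → R.hears q = R'.hears q)
    (hr : ∀ q, q.1 ≤ T → q ≠ p → R.release q = R'.release q) :
    (R.lazy (T + 1)).Decides F = (R'.lazy (T + 1)).Decides F := by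
  set X := R.lazy (T + 1) with hX
  have hXv : X.Valid := hR.valid.valid_lazy
  have hXp : X.release p = T := by
    rw [hX, release_lazy_of_lt (by omega) (by rw [hp]; exact_mod_cast T.lt_succ_self), hp]
  -- In `X` nobody hears `p` before `T + 2`, so its release can be moved from `T` to `T + 1` without
  -- touching any inbox. The result continues the prefix of `R'`.
  let Y : Schedule k := ⟨X.input, Function.update X.release p ((T + 1 : ℕ) : ℕ∞), X.hears⟩
  have hYp : Y.release p = ((T + 1 : ℕ) : ℕ∞) := by simp [Y]
  have hYq : ∀ q, q ≠ p → Y.release q = X.release q := fun q hq => by simp [Y, hq]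
  have hsame : SameUpTo (T + 1) R' Y := by
    have hs := sameUpTo_lazy (T + 1) R
    refine ⟨fun q hq => ?_, fun q hq => ?_, fun q hq hrq => ?_⟩
    · rw [← hi q (by omega)]; exact hs.input q hq
    · rw [← hh q (by omega)]; exact hs.hears q hq
    · by_cases hqp : q = p
      · subst hqp
        rw [hYp] at hrq
        rcases hrq with h | h
        · exfalso
          push_cast at h
          exact absurd (Order.add_one_le_of_lt hp') (not_le.2 h)
        · exact absurd h (lt_irrefl _)
      · rw [hYq q hqp] at hrq ⊢
        rw [← hr q (by omega) hqp] at hrq ⊢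
        exact hs.release q hq hrq
  have hYlate : ∀ q, q.1 ≤ T → Y.Late q → R'.Late q := fun q hq h =>
    (hsame.late_iff (by omega)).2 h
  have hXlate : ∀ q, Y.Late q → q ≠ p → X.Late q := fun q h hqp => by
    simpa [Late, hYq q hqp] using h
  have hYv : Y.Valid := by
    refine fun S => ⟨fun q hq => ?_, fun q q' hq hqq h1 h2 => ?_, fun q q' hq hqq => ?_,
      fun q q' hq hqq hle => ?_⟩
    · by_cases hqp : q = p
      · subst hqp
        rw [hYp]
        exact_mod_cast (by omega : q.1 ≤ T + 1)
      · rw [hYq q hqp]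
        exact (hXv S).le_release q hq
    · by_cases hqT : q.1 ≤ T
      · exact hR'.valid.late_unique q q' (by omega) hqq (hYlate q hqT h1)
          (hYlate q' (by omega) h2)
      · exact (hXv S).late_unique q q' hq hqq (hXlate q h1 (by rintro rfl; exact hqT hpT))
          (hXlate q' h2 (by rintro rfl; omega))
    · have h1 := (hXv S).released q q' hq hqq
      refine ⟨h1.1, ?_⟩
      by_cases hqp : q' = p
      · subst hqp
        rw [hYp]
        have h2 := h1.2
        rw [hXp] at h2
        have h3 : T + 1 ≤ q.1 := by exact_mod_cast h2
        have hqq' : q' ∈ X.hears q := hqq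
        rw [hX, hears_lazy h3] at hqq'
        have h4 := hqq'.2
        rw [← hX, hXp] at h4
        norm_cast at h4 ⊢
      · rw [hYq q' hqp]
        exact h1.2
    · refine (hXv S).hears q q' hq hqq ?_
      by_cases hqp : q' = p
      · subst hqp
        rw [hYp] at hle
        rw [hXp]
        norm_cast at hle ⊢
        omega
      · rwa [hYq q' hqp] at hle
  rw [hR'.decides_eq hU hsame hYv]
  -- Inboxes and inputs are unchanged; the only possible new late player is `p`, whose output merely
  -- stops counting.
  refine decides_eq_of_subset hF hXv hYv fun q hq => ⟨?_, ?_⟩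
  · by_cases hqp : q = p
    · subst hqp
      exfalso
      apply hq
      rw [Late, hYp]
      norm_cast
      omega
    · simpa [Late, hYq q hqp] using hq
  · exact behaviour_congr (R := X) (R' := Y) F Set.univ (fun _ _ => rfl) (fun _ _ => rfl)
      (fun _ _ _ _ _ => trivial) q trivial

/-- What a player receives whose messages are withheld does not affect the decision. -/
lemma Extends.decides_change (hF : Decisive F) {T : ℕ} {R₀ R R' : Schedule k}
    (hR : Extends T R₀ R) (hR' : Extends T R₀ R') {p : ℕ × Fin k}
    (hpT : p.1 = T) (hp : T < R.release p)
    (hi : ∀ q, q.1 ≤ T → q ≠ p → R.input q = R'.input q)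
    (hh : ∀ q, q.1 ≤ T → q ≠ p → R.hears q = R'.hears q)
    (hr : ∀ q, q.1 ≤ T → R.release q = R'.release q) :
    (R.lazy (T + 1)).Decides F = (R'.lazy (T + 1)).Decides F := by
  have hrel : (R.lazy (T + 1)).release = (R'.lazy (T + 1)).release := by
    funext q
    by_cases hq : q.1 ≤ T
    · simp [lazy, hq, hr q hq]
    · rw [release_lazy_of_le (by omega), release_lazy_of_le (by omega)]
  have hlate : ∀ q, (R.lazy (T + 1)).Late q ↔ (R'.lazy (T + 1)).Late q := fun q => by
    rw [Late, Late, hrel]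
  have htop : (R.lazy (T + 1)).release p = ⊤ :=
    release_lazy_eq_top (by omega) (by push_cast; exact Order.add_one_le_of_lt hp)
  have hpl : (R.lazy (T + 1)).Late p := by
    rw [Late, htop]; exact ENat.top_ne_natCast _
  refine decides_eq_of_subset hF hR.valid.valid_lazy hR'.valid.valid_lazy fun q hq =>
    ⟨fun h => hq ((hlate q).1 h), ?_⟩
  -- `lazy` never releases what is withheld at the cut, so nobody hears `p`, and the other players
  -- form a closed set.
  refine behaviour_congr F {q | q ≠ p} (fun q hqp => ?_) (fun q hqp => ?_)
    (fun q _ q' hq' _ hqp => ?_) q ?_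
  · by_cases hqT : q.1 ≤ T
    · rw [← (sameUpTo_lazy (T + 1) R).input q (by omega),
        ← (sameUpTo_lazy (T + 1) R').input q (by omega), hi q hqT hqp]
    · simp [lazy, hqT]
  · by_cases hqT : q.1 ≤ T
    · rw [← (sameUpTo_lazy (T + 1) R).hears q (by omega),
        ← (sameUpTo_lazy (T + 1) R').hears q (by omega), hh q hqT hqp]
    · rw [hears_lazy (by omega), hears_lazy (by omega), hrel]
  · subst hqp
    have := (hR.valid.valid_lazy (q.1 + 1)).released q q' q.1.lt_succ_self hq'
    rw [htop] at this
    exact not_top_lt this.2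
  · rintro rfl
    exact hq ((hlate q).1 hpl)

/-- Release at `T` the withheld messages of the players in `s`. -/
noncomputable def releaseOn (T : ℕ) (s : Finset (ℕ × Fin k)) (R : Schedule k) : Schedule k :=
  open Classical in
  { R with release := fun p => if p ∈ s ∧ p.1 ≤ T then min (R.release p) T else R.release p }

lemma releaseOn_release_of_mem {T : ℕ} {s : Finset (ℕ × Fin k)} {R : Schedule k} {p : ℕ × Fin k}
    (hp : p ∈ s) (hpT : p.1 ≤ T) : (R.releaseOn T s).release p = min (R.release p) T := by
  simp [releaseOn, hp, hpT]

lemma releaseOn_release_of_notMem {T : ℕ} {s : Finset (ℕ × Fin k)} {R : Schedule k}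
    {p : ℕ × Fin k} (hp : p ∉ s) : (R.releaseOn T s).release p = R.release p := by
  simp [releaseOn, hp]

lemma releaseOn_release {T : ℕ} {s : Finset (ℕ × Fin k)} {R : Schedule k} {p : ℕ × Fin k} :
    (R.releaseOn T s).release p = R.release p ∨
      p.1 ≤ T ∧ T < R.release p ∧ (R.releaseOn T s).release p = T := by
  by_cases hp : p ∈ s ∧ p.1 ≤ T
  · rw [releaseOn_release_of_mem hp.1 hp.2]
    rcases le_or_gt (R.release p) T with h | h
    · exact Or.inl (min_eq_left h)
    · exact Or.inr ⟨hp.2, h, min_eq_right h.le⟩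
  · left
    simp [releaseOn, hp]

/-- Early release can only make fewer players late, and what is released at `T` cannot be heard by
groups up to `T`. -/
lemma Extends.releaseOn {T : ℕ} {R₀ R : Schedule k} (hR : Extends T R₀ R)
    (s : Finset (ℕ × Fin k)) : Extends T R₀ (R.releaseOn T s) := by
  have hl : ∀ p, (R.releaseOn T s).Late p → R.Late p := fun p h => by
    rcases releaseOn_release (T := T) (s := s) (R := R) (p := p) with h1 | ⟨h1, h2, -⟩
    · rwa [Late, h1] at h
    · intro h3
      rw [h3] at h2
      exact absurd h1 (not_le.2 (by exact_mod_cast h2))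
  refine ⟨⟨fun p hp => ?_, fun p q hp hpq h1 h2 => ?_, fun q p hq hp => ?_,
    fun q p hq hpq hle => ?_⟩, hR.same.trans ⟨fun _ _ => rfl, fun _ _ => rfl, fun p _ h => ?_⟩⟩
  · rcases releaseOn_release (T := T) (s := s) (R := R) (p := p) with h1 | ⟨h1, -, h3⟩
    · rw [h1]; exact hR.valid.le_release p hp
    · rw [h3]; exact_mod_cast h1
  · exact hR.valid.late_unique p q hp hpq (hl p h1) (hl q h2)
  · have h := hR.valid.released q p hq hp
    refine ⟨h.1, ?_⟩
    rcases releaseOn_release (T := T) (s := s) (R := R) (p := p) with h1 | ⟨-, h2, -⟩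
    · rw [h1]; exact h.2
    · have := h2.trans h.2
      norm_cast at this
      omega
  · rcases releaseOn_release (T := T) (s := s) (R := R) (p := p) with h1 | ⟨-, -, h3⟩
    · rw [h1] at hle
      exact hR.valid.hears q p hq hpq hle
    · rw [h3] at hle
      norm_cast at hle
      omega
  · rcases releaseOn_release (T := T) (s := s) (R := R) (p := p) with h1 | ⟨-, h2, h3⟩
    · exact h1.symm
    · rw [h3] at h
      rcases h with h | h
      · exact absurd h h2.not_gt
      · exact absurd h (lt_irrefl _)

/-- One player at a time: releasing pending messages of `p` at `T` is `Extends.decides_withhold`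
read backwards, and without pending messages nothing changes. -/
lemma Extends.decides_releaseOn (hF : Decisive F) {T : ℕ} {R₀ R : Schedule k}
    (hU : Univalent F T R₀) (hR : Extends T R₀ R) (s : Finset (ℕ × Fin k)) :
    ((R.releaseOn T s).lazy (T + 1)).Decides F = (R.lazy (T + 1)).Decides F := by
  classical
  induction s using Finset.induction_on with
  | empty => simp [Schedule.releaseOn]
  | insert p s hp ih =>
    rw [← ih]
    by_cases h : p.1 ≤ T ∧ T < R.release p
    · refine (hR.releaseOn _).decides_withhold hF hU (hR.releaseOn s) h.1 ?_ ?_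
        (fun _ _ => rfl) (fun _ _ => rfl) (fun q _ hq => ?_)
      · rw [releaseOn_release_of_mem (by simp) h.1, min_eq_right h.2.le]
      · rw [releaseOn_release_of_notMem hp]; exact h.2
      · simp [Schedule.releaseOn, hq]
    · have : R.releaseOn T (insert p s) = R.releaseOn T s := by
        rw [Schedule.releaseOn, Schedule.releaseOn]
        congr 1
        funext q
        by_cases hq : q = p
        · subst hq
          by_cases hqT : q.1 ≤ T
          · simp only [Finset.mem_insert, true_or, hqT, and_self, if_true, hp, false_and, if_false]
            exact min_eq_left (not_lt.1 fun h' => h ⟨hqT, h'⟩)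
          · simp [hqT]
        · simp [hq]
      rw [this]

/-- Take inputs and receptions of the players in `s` from `R'`. -/
noncomputable def mix (s : Finset (ℕ × Fin k)) (R R' : Schedule k) : Schedule k :=
  open Classical in
  { input := fun p => if p ∈ s then R'.input p else R.input p
    release := R.release
    hears := fun p => if p ∈ s then R'.hears p else R.hears p }

/-- Receptions can be exchanged freely because both schedules have the same release dates. -/
lemma Extends.mix {T : ℕ} {R₀ R R' : Schedule k} (hR : Extends T R₀ R) (hR' : Extends T R₀ R')
    (hr : ∀ p, p.1 ≤ T → R.release p = R'.release p) (s : Finset (ℕ × Fin k)) :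
    Extends T R₀ (R.mix s R') := by
  refine ⟨⟨hR.valid.le_release, hR.valid.late_unique, fun q p hq hp => ?_,
    fun q p hq hpq hle => ?_⟩, hR.same.trans ⟨fun p hp => ?_, fun p hp => ?_, fun _ _ _ => rfl⟩⟩
  · by_cases hs : q ∈ s
    · simp only [Schedule.mix, hs, if_true] at hp ⊢
      have := hR'.valid.released q p hq hp
      rw [hr p (by omega)]
      exact this
    · simp only [Schedule.mix, hs, if_false] at hp ⊢
      exact hR.valid.released q p hq hp
  · by_cases hs : q ∈ s
    · simp only [Schedule.mix, hs, if_true] at hle ⊢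
      rw [hr p (by omega)] at hle
      exact hR'.valid.hears q p hq hpq hle
    · simp only [Schedule.mix, hs, if_false] at hle ⊢
      exact hR.valid.hears q p hq hpq hle
  · simp only [Schedule.mix]
    split_ifs
    · rw [← hR.same.input p hp, hR'.same.input p hp]
    · rfl
  · simp only [Schedule.mix]
    split_ifs
    · rw [← hR.same.hears p hp, hR'.same.hears p hp]
    · rfl

/-- Never release the messages of `p`. -/
noncomputable def silence (p : ℕ × Fin k) (R : Schedule k) : Schedule k :=
  open Classical in { R with release := Function.update R.release p ⊤ }

/-- The rest of group `T` is punctual, so silencing `p` makes it the only late player there. -/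
lemma Extends.silence {T : ℕ} {R₀ R : Schedule k} (hR : Extends T R₀ R)
    (hr : ∀ p, p.1 = T → R.release p = T) {p : ℕ × Fin k} (hp : p.1 = T) :
    Extends T R₀ (R.silence p) := by
  have hne : ∀ q, q ≠ p → (R.silence p).release q = R.release q := fun q hq => by
    simp [Schedule.silence, hq]
  have heq : (R.silence p).release p = ⊤ := by simp [Schedule.silence]
  have hl : ∀ q, q.1 = T → (R.silence p).Late q → q = p := fun q hq h => by
    by_contra hqp
    rw [Late, hne q hqp, hr q hq, hq] at h
    exact h rfl
  have hl' : ∀ q, q ≠ p → (R.silence p).Late q → R.Late q := fun q hq h => by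
    rwa [Late, hne q hq] at h
  refine ⟨⟨fun q hq => ?_, fun q q' hq hqq h1 h2 => ?_, fun q q' hq hqq => ?_,
    fun q q' hq hqq hle => ?_⟩, hR.same.trans ⟨fun _ _ => rfl, fun _ _ => rfl, fun q hq _ => ?_⟩⟩
  · by_cases h : q = p
    · rw [h, heq]; exact le_top
    · rw [hne q h]; exact hR.valid.le_release q hq
  · by_cases h : q.1 = T
    · rw [hl q h h1, hl q' (hqq ▸ h) h2]
    · exact hR.valid.late_unique q q' hq hqq (hl' q (by rintro rfl; exact h hp) h1)
        (hl' q' (by rintro rfl; omega) h2)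
  · have h1 := hR.valid.released q q' hq hqq
    rw [hne q' (by rintro rfl; omega)]
    exact h1
  · rw [hne q' (by rintro rfl; omega)] at hle
    exact hR.valid.hears q q' hq hqq hle
  · rw [hne q (by rintro rfl; omega)]

/-- A player of group `T` is silenced, altered while nobody hears it, and restored. For a player of
an earlier group there is nothing to do: both schedules agree there with `R₀`. -/
lemma Extends.decides_mix (hF : Decisive F) {T : ℕ} {R₀ R R' : Schedule k}
    (hU : Univalent F T R₀) (hR : Extends T R₀ R) (hR' : Extends T R₀ R')
    (hr : ∀ p, p.1 ≤ T → R.release p = R'.release p)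
    (hT : ∀ p, p.1 = T → R.release p = T) (s : Finset (ℕ × Fin k)) :
    ((R.mix s R').lazy (T + 1)).Decides F = (R.lazy (T + 1)).Decides F := by
  classical
  induction s using Finset.induction_on with
  | empty => simp [Schedule.mix]
  | insert p s hp ih =>
    rw [← ih]
    have e1 := hR.mix hR' hr (insert p s)
    have e2 := hR.mix hR' hr s
    by_cases hpT : p.1 = T
    · have hl : (T : ℕ∞) < ⊤ := ENat.natCast_lt_top T
      have s1 := e1.silence hT hpT
      have s2 := e2.silence hT hpT
      calc _ = (((R.mix (insert p s) R').silence p).lazy (T + 1)).Decides F :=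
            e1.decides_withhold hF hU s1 hpT.le (hT p hpT) (by simp [Schedule.silence])
              (fun _ _ => rfl) (fun _ _ => rfl) (fun q _ hq => by simp [Schedule.silence, hq])
        _ = (((R.mix s R').silence p).lazy (T + 1)).Decides F :=
            s1.decides_change hF s2 hpT (by simp [Schedule.silence])
              (fun q _ hq => by simp [Schedule.silence, Schedule.mix, hq])
              (fun q _ hq => by simp [Schedule.silence, Schedule.mix, hq])
              (fun q _ => rfl)
        _ = _ := (e2.decides_withhold hF hU s2 hpT.le (hT p hpT)
              (by simp [Schedule.silence])
              (fun _ _ => rfl) (fun _ _ => rfl)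
              (fun q _ hq => by simp [Schedule.silence, hq])).symm
    · refine e1.decides_eq' hU ⟨fun q hq => ?_, fun q hq => ?_, fun _ _ _ => rfl⟩
      · by_cases hqp : q = p
        · subst hqp
          simp only [Schedule.mix, Finset.mem_insert_self, if_true, hp, if_false]
          rw [← hR.same.input q (by omega), hR'.same.input q (by omega)]
        · simp [Schedule.mix, hqp]
      · by_cases hqp : q = p
        · subst hqp
          simp only [Schedule.mix, Finset.mem_insert_self, if_true, hp, if_false]
          rw [← hR.same.hears q (by omega), hR'.same.hears q (by omega)]
        · simp [Schedule.mix, hqp]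

/-- Once everything pending is released at `T`, the two prefixes have equal release dates, and
`Extends.decides_mix` turns the inputs and inboxes of one into those of the other. -/
lemma Univalent.decides_eq (hF : Decisive F) {T : ℕ} {R₀ R R' : Schedule k}
    (hU : Univalent F T R₀) (hR : R.Valid) (hR' : R'.Valid) (h : SameUpTo T R₀ R)
    (h' : SameUpTo T R₀ R') : R.Decides F = R'.Decides F := by
  classical
  have e : Extends T R₀ R := ⟨hR _, h⟩
  have e' : Extends T R₀ R' := ⟨hR' _, h'⟩
  set s : Finset (ℕ × Fin k) := Finset.range (T + 1) ×ˢ Finset.univ with hs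
  have hmem : ∀ p : ℕ × Fin k, p.1 ≤ T → p ∈ s := fun p hp => by
    simp [hs, hp]
  have hT : ∀ {Q : Schedule k}, Extends T R₀ Q → ∀ p, p.1 = T → (Q.releaseOn T s).release p = T :=
    fun {Q} eQ p hp => by
      rw [releaseOn_release_of_mem (hmem p hp.le) hp.le]
      refine min_eq_right ?_
      rw [← hp]
      exact eQ.valid.le_release p (by omega)
  have hr : ∀ p, p.1 ≤ T → (R.releaseOn T s).release p = (R'.releaseOn T s).release p := by
    intro p hp
    rcases hp.lt_or_eq with hp' | hp'
    · rw [releaseOn_release_of_mem (hmem p hp) hp, releaseOn_release_of_mem (hmem p hp) hp]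
      have := (h.symm.trans h').release p hp'
      -- Dates before `T` belong to the common prefix; all others collapse to `T`.
      by_cases hc : R.release p < T ∨ R'.release p < T
      · rw [this hc]
      · rw [not_or, not_lt, not_lt] at hc
        rw [min_eq_right hc.1, min_eq_right hc.2]
    · rw [hT e p hp', hT e' p hp']
  have f := e.releaseOn s
  have f' := e'.releaseOn s
  rw [← e.decides_eq hU (SameUpTo.refl _ _) hR, ← e'.decides_eq hU (SameUpTo.refl _ _) hR',
    ← e.decides_releaseOn hF hU s, ← e'.decides_releaseOn hF hU s,
    ← f.decides_mix hF hU f' hr (hT e) s]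
  refine (f.mix f' hr s).decides_eq' hU ⟨fun p hp => ?_, fun p hp => ?_, fun p hp _ => ?_⟩
  · simp [Schedule.mix, hmem p (by omega)]
  · simp [Schedule.mix, hmem p (by omega)]
  · exact hr p (by omega)

/-! ### The undecided schedule -/

/-- The prefix of length `T` of `R` can be continued to either decision. -/
def Bivalent (F : ℕ × Fin k → Bool → Multiset M → Finset M × Option Bool)
    (T : ℕ) (R : Schedule k) : Prop :=
  ∃ R₁ R₂ : Schedule k, R₁.Valid ∧ R₂.Valid ∧ SameUpTo T R R₁ ∧ SameUpTo T R R₂ ∧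
    R₁.Decides F ≠ R₂.Decides F

/-- If no extension by one timeslot were bivalent, the prefix would satisfy `Univalent`, and then
all its continuations would decide alike. -/
lemma Bivalent.exists_succ (hF : Decisive F) {T : ℕ} {R : Schedule k} (h : Bivalent F T R) :
    ∃ R' : Schedule k, R'.Valid ∧ SameUpTo T R R' ∧ Bivalent F (T + 1) R' := by
  by_contra! hcon
  obtain ⟨R₁, R₂, h1, h2, s1, s2, hne⟩ := h
  refine hne (Univalent.decides_eq hF (R₀ := R) (T := T) (fun Q Q' hQ hQ' hs hs' => ?_)
    h1 h2 s1 s2)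
  by_contra hd
  exact hcon Q hQ hs ⟨Q, Q', hQ, hQ', SameUpTo.refl _ _, hs', hd⟩

open Classical in
/-- The limit of a sequence of schedules whose prefixes stabilize. -/
noncomputable def limit (Q : ℕ → Schedule k) : Schedule k where
  input p := (Q (p.1 + 1)).input p
  hears p := (Q (p.1 + 1)).hears p
  -- A release date is settled as soon as some prefix contains it; if it recedes forever, the
  -- messages never come out.
  release p := if h : ∃ n, p.1 < n ∧ (Q n).release p < n then (Q (Nat.find h)).release p else ⊤

lemma sameUpTo_limit {Q : ℕ → Schedule k} (hQ : ∀ n, SameUpTo n (Q n) (Q (n + 1))) (T : ℕ) :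
    SameUpTo T (Q T) (limit Q) := by
  have hmono : ∀ n m, n ≤ m → SameUpTo n (Q n) (Q m) := fun n m hnm => by
    induction m, hnm using Nat.le_induction with
    | base => exact SameUpTo.refl _ _
    | succ m hm ih => exact ih.trans ((hQ m).mono hm)
  refine ⟨fun p hp => ?_, fun p hp => ?_, fun p hp hr => ?_⟩
  · exact ((hmono (p.1 + 1) T hp).input p p.1.lt_succ_self).symm
  · exact ((hmono (p.1 + 1) T hp).hears p p.1.lt_succ_self).symm
  · classical
    have hex : ∃ n, p.1 < n ∧ (Q n).release p < n := by
      by_contra hcon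
      rcases hr with hr | hr
      · exact hcon ⟨T, hp, hr⟩
      · simp only [limit, hcon, dif_neg, not_false_iff] at hr
        exact not_top_lt hr
    have hlim : (limit Q).release p = (Q (Nat.find hex)).release p := by
      simp only [limit, hex, dif_pos]
    obtain ⟨hn1, hn2⟩ := Nat.find_spec hex
    rw [hlim] at hr ⊢
    rcases le_total (Nat.find hex) T with hle | hle
    · exact ((hmono _ T hle).release p hn1 (Or.inl hn2)).symm
    · exact (hmono T _ hle).release p hp hr

/-- If decisions are unique for each schedule and respect unanimous inputs, then some schedule leads
to no decision. -/
theorem exists_valid_undecided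
    (huniq : ∀ R : Schedule k, R.Valid → ∀ b b', R.Decides F b → R.Decides F b' → b = b')
    (hvalid : ∀ R : Schedule k, R.Valid → ∀ b, (∀ p, R.input p = b) →
      ∀ b', R.Decides F b' → b' = b) :
    ∃ R : Schedule k, R.Valid ∧ ∀ b, ¬ R.Decides F b := by
  by_contra! hcon
  have hF : Decisive F := ⟨hcon, huniq⟩
  let C : Bool → Schedule k := fun b =>
    ⟨fun _ => b, fun p => p.1, fun q => {p | p.1 < q.1}⟩
  have hC : ∀ b, (C b).Valid := fun b T =>
    ⟨fun _ _ => le_rfl, fun _ _ _ _ h => absurd rfl h,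
      fun q p _ hp => ⟨hp, Nat.cast_lt.2 hp⟩, fun _ _ _ hp _ => hp⟩
  -- The empty prefix does not even constrain the inputs, so both unanimous schedules continue it.
  have h0 : Bivalent F 0 (C true) := by
    refine ⟨C true, C false, hC _, hC _, SameUpTo.zero _ _, SameUpTo.zero _ _, fun h => ?_⟩
    obtain ⟨b, hb⟩ := hcon (C true) (hC _)
    have h1 := hvalid _ (hC true) true (fun _ => rfl) b hb
    rw [h] at hb
    have h2 := hvalid _ (hC false) false (fun _ => rfl) b hb
    rw [h1] at h2
    exact absurd h2 (by decide)
  choose! next hnv hns hnb using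
    fun (n : ℕ) (R : Schedule k) (h : Bivalent F n R) => h.exists_succ hF
  let Q : ℕ → Schedule k := fun n => Nat.rec (C true) (fun n R => next n R) n
  have hQ : ∀ n, Bivalent F n (Q n) := fun n => by
    induction n with
    | zero => exact h0
    | succ n ih => exact hnb n _ ih
  have hlim := sameUpTo_limit (Q := Q) fun n => hns n _ (hQ n)
  have hv : (limit Q).Valid := by
    intro T
    cases T with
    | zero => exact (SameUpTo.zero _ _).validUpTo (hC true 0)
    | succ n => exact (hlim (n + 1)).validUpTo (hnv n _ (hQ n) (n + 1))
  obtain ⟨b, p, hp, hb⟩ := hcon _ hv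
  obtain ⟨R₁, R₂, h1, h2, s1, s2, hne⟩ := hQ (p.1 + 1)
  -- The output of a punctual player is determined by the prefix that ends with its own timeslot, so
  -- both witnesses of bivalence must decide `b`.
  have key : ∀ R : Schedule k, SameUpTo (p.1 + 1) (Q (p.1 + 1)) R → R.Decides F b := fun R hR => by
    have hs := (hlim (p.1 + 1)).symm.trans hR
    refine ⟨p, fun hl => hp ((hs.late_iff p.1.lt_succ_self).2 hl), ?_⟩
    rw [← hs.behaviour_eq F p.1.lt_succ_self]
    exact hb
  apply hne
  funext b'
  refine propext ⟨fun h => ?_, fun h => ?_⟩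
  · rw [huniq _ h1 b' b h (key _ s1)]; exact key _ s2
  · rw [huniq _ h2 b' b h (key _ s2)]; exact key _ s1

end Schedule

end Permissionless

namespace Permissionless

universe u v w x y

/-! ### What one run of the protocol changes in a player. -/

section Slot

variable {Id : Type u} {Data : Type v} {Tx : Type w} {O : Type x} {pay : PaymentSystem Id Tx}
  (π : Protocol.{u, v, w, x, y} Id Data Tx O pay) (par : Params Id O)
  (ids : Set Id) (bal : O → ℕ) (t : ℕ)

lemma iterStep_iterate_invariant (n : ℕ) (L : LocalState π) :
    ((iterStep π par ids bal t)^[n] L).log = L.log ∧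
      ((iterStep π par ids bal t)^[n] L).stuckAt = L.stuckAt ∧
      ((iterStep π par ids bal t)^[n] L).heardMsg = L.heardMsg := by
  induction n with
  | zero => exact ⟨rfl, rfl, rfl⟩
  | succ n ih =>
    rw [Function.iterate_succ_apply']
    set L' := (iterStep π par ids bal t)^[n] L
    rw [← ih.1, ← ih.2.1, ← ih.2.2]
    unfold iterStep
    split_ifs
    · exact ⟨rfl, rfl, rfl⟩
    · exact ⟨rfl, rfl, rfl⟩

variable (M : Multiset (Msg Id Data Tx O)) (L : LocalState π)

lemma runSlot_log_of_ne {t' : ℕ} (h : t' ≠ t) :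
    (runSlot π par ids bal t M L).log t' = L.log t' := by
  unfold runSlot
  split_ifs with hn
  · have := fun n => (iterStep_iterate_invariant π par ids bal t n (beginSlot π bal t M L)).1
    simp only [endSlot, Function.update_of_ne h, this]
    rfl
  · rfl

lemma runSlot_stuckAt_cases :
    (runSlot π par ids bal t M L).stuckAt = L.stuckAt ∨
      (runSlot π par ids bal t M L).stuckAt = insert t L.stuckAt ∧
        (runSlot π par ids bal t M L).log = L.log := by
  unfold runSlot
  split_ifs with hn
  · left
    exact (iterStep_iterate_invariant π par ids bal t _ (beginSlot π bal t M L)).2.1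
  · exact Or.inr ⟨rfl, rfl⟩

/-- A transaction is permitted only if it was heard in a message; oracle responses cannot supply it.
-/
lemma tx_heard_of_mem_runSlot_log (h : L.log t = ∅) {m : Msg Id Data Tx O}
    (hm : m ∈ (runSlot π par ids bal t M L).log t) {a : Tx} (ha : Entry.tx a ∈ m) :
    Entry.tx a ∈ L.heardMsg ∨ ∃ m' ∈ M, Entry.tx a ∈ m' := by
  unfold runSlot at hm
  split_ifs at hm with hn
  · have := fun n => (iterStep_iterate_invariant π par ids bal t n (beginSlot π bal t M L)).2.2
    simp only [endSlot, Function.update_self, Finset.mem_filter] at hm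
    have h2 := hm.2 _ ha
    simp only [PermittedEntry, LocalState.collect, this] at h2
    exact h2
  · change m ∈ L.log t at hm
    simp [h] at hm

end Slot

/-! ### Schedules as executions of the protocol. -/

namespace Schedule

section

variable {k : ℕ} {M : Type*} (F : ℕ × Fin k → Bool → Multiset M → Finset M × Option Bool)

open Classical in
/-- The messages received by `q`. -/
noncomputable def inbox (R : Schedule k) (q : ℕ × Fin k) : Multiset M :=
  ∑ p ∈ Finset.range q.1 ×ˢ Finset.univ,
    if p ∈ R.hears q then (R.behaviour F p.1 p.2).1.val else 0

lemma behaviour_eq_inbox (R : Schedule k) (q : ℕ × Fin k) :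
    R.behaviour F q.1 q.2 = F q (R.input q) (R.inbox F q) := by
  rw [behaviour, inbox, Finset.sum_product, Finset.sum_range]

end

variable {Id : Type u} {Data : Type v} {Tx : Type w} {O : Type x} {pay : PaymentSystem Id Tx}
  (π : Protocol.{u, v, w, x, y} Id Data Tx O pay) (par : Params Id O) {k : ℕ}
  (f : ℕ × Fin k → Id)

/-- The situation of a player that has not been active yet. -/
def initialState (p : ℕ × Fin k) (b : Bool) : LocalState π where
  state := π.diagram.start par {f p} b
  undelivered := ∅
  heardMsg := ∅
  heardResp := ∅
  spent := fun _ => 0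
  log := fun _ => ∅
  stuckAt := ∅

open Classical in
/-- One unit of every external resource. -/
noncomputable def unitBalance (o : O) : ℕ := if (π.oracle o).kind = .ordinary then 0 else 1

/-- The situation of a player after its only timeslot. -/
noncomputable def finalState (p : ℕ × Fin k) (b : Bool) (M : Multiset (Msg Id Data Tx O)) :
    LocalState π :=
  runSlot π par {f p} (unitBalance π) p.1 M (initialState π par f p b)

open Classical in
/-- The messages and the output of a player that is active at a single timeslot. -/
noncomputable def reaction (p : ℕ × Fin k) (b : Bool) (M : Multiset (Msg Id Data Tx O)) :
    Finset (Msg Id Data Tx O) × Option Bool :=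
  ((finalState π par f p b M).log p.1,
    if p.1 ∈ (finalState π par f p b M).stuckAt then none
    else π.diagram.output (finalState π par f p b M).state)

variable (R : Schedule k)

open Classical in
/-- The execution described by a schedule. The late players are Byzantine, halt after their only
timeslot, and are active again, without resources, when their messages are released. -/
noncomputable def execution : Execution Id Data Tx O (ℕ × Fin k) where
  ids p := {f p}
  input := R.input
  allocated t := (Finset.range (t + 1) ×ˢ Finset.univ).filter fun p => p.1 = t ∨ R.release p = t
  byzantine := {p | R.Late p}
  balance o p t := if p.1 = t then unitBalance π o else 0
  halt p := if R.Late p then ((p.1 + 1 : ℕ) : ℕ∞) else ⊤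
  -- The log is empty at all timeslots other than `p.1`; the value `t` there only serves
  -- `honest_release` and `le_release`.
  release p t _ := if t = p.1 then R.release p else t
  timing p q _ t :=
    if p = q then some (t + 1)
    else if t < q.1 ∧ p ∈ R.hears q then some q.1
    -- A late receiver is active again at its release and must by then have received what is due.
    -- Delivery at that moment is harmless, as it has halted.
    else if ∃ r : ℕ, R.release q = r ∧ q.1 < r ∧ t < r then some (R.release q).toNat
    else none
  env _ _ := ∅

variable {R}

lemma mem_allocated (hR : R.Valid) {p : ℕ × Fin k} {t : ℕ} :
    p ∈ (R.execution π f).allocated t ↔ p.1 = t ∨ R.release p = t := by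
  simp only [execution, Finset.mem_filter, Finset.mem_product, Finset.mem_range, Finset.mem_univ,
    and_true, and_iff_right_iff_imp]
  rintro (h | h)
  · omega
  · have := (hR (p.1 + 1)).le_release p p.1.lt_succ_self
    rw [h] at this
    have : p.1 ≤ t := by exact_mod_cast this
    omega

lemma history_of_le (hR : R.Valid) (p : ℕ × Fin k) {t : ℕ} (ht : t ≤ p.1) :
    (R.execution π f).history π par t p = initialState π par f p (R.input p) := by
  induction t with
  | zero => rfl
  | succ t ih =>
    rw [← ih (by omega), Execution.history]
    refine if_neg ?_
    rintro ⟨⟨h, -⟩, -⟩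
    rcases (mem_allocated π f hR).1 h with h | h
    · omega
    · have := (hR (p.1 + 1)).le_release p p.1.lt_succ_self
      rw [h] at this
      have : p.1 ≤ t := by exact_mod_cast this
      omega

lemma activeIn_history_self (hR : R.Valid) (p : ℕ × Fin k) :
    (R.execution π f).activeIn ((R.execution π f).history π par p.1) p.1 p := by
  refine ⟨(mem_allocated π f hR).2 (Or.inl rfl), fun t _ => ?_⟩
  rw [history_of_le π par f hR p le_rfl]
  exact Set.notMem_empty t

lemma finalState_log_of_ne (p : ℕ × Fin k) (b : Bool) (M : Multiset (Msg Id Data Tx O)) {t : ℕ}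
    (ht : t ≠ p.1) : (finalState π par f p b M).log t = ∅ :=
  runSlot_log_of_ne π par _ _ _ M _ ht

/-- A run that does not terminate logs nothing, so the rule that a stuck player cannot disseminate
agrees with `behaviour`. -/
lemma finalState_stuck (p : ℕ × Fin k) (b : Bool) (M : Multiset (Msg Id Data Tx O)) {t : ℕ}
    (ht : t ∈ (finalState π par f p b M).stuckAt) :
    t = p.1 ∧ ∀ t', (finalState π par f p b M).log t' = ∅ := by
  rcases runSlot_stuckAt_cases π par {f p} (unitBalance π) p.1 M (initialState π par f p b) with
    h | ⟨h, h'⟩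
  · rw [finalState, h] at ht
    exact absurd ht (Set.notMem_empty t)
  · rw [finalState, h] at ht
    refine ⟨by simpa [initialState] using ht, fun t' => ?_⟩
    rw [finalState, h']
    rfl

/-- By timeslot `t`, the players of earlier groups have acted once, as the schedule prescribes. -/
def HistoryUpTo (R : Schedule k) (t : ℕ) : Prop :=
  ∀ p : ℕ × Fin k, p.1 < t → (R.execution π f).history π par t p =
    finalState π par f p (R.input p) (R.inbox (reaction π par f) p)

variable {π par f}

lemma HistoryUpTo.log_of_ne (hR : R.Valid) {t : ℕ} (h : HistoryUpTo π par f R t)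
    (p : ℕ × Fin k) {t' : ℕ} (ht : t' ≠ p.1) :
    ((R.execution π f).history π par t p).log t' = ∅ := by
  rcases lt_or_ge p.1 t with hp | hp
  · rw [h p hp, finalState_log_of_ne π par f _ _ _ ht]
  · rw [history_of_le π par f hR p hp]
    rfl

lemma HistoryUpTo.log_self {t : ℕ} (h : HistoryUpTo π par f R t) {p : ℕ × Fin k} (hp : p.1 < t) :
    ((R.execution π f).history π par t p).log p.1 =
      (R.behaviour (reaction π par f) p.1 p.2).1 := by
  rw [h p hp, behaviour_eq_inbox]
  rfl

lemma HistoryUpTo.stuck (hR : R.Valid) {t : ℕ} (h : HistoryUpTo π par f R t)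
    {p : ℕ × Fin k} {t' : ℕ} (ht : t' ∈ ((R.execution π f).history π par t p).stuckAt) :
    t' = p.1 ∧ ∀ t'', ((R.execution π f).history π par t p).log t'' = ∅ := by
  rcases lt_or_ge p.1 t with hp | hp
  · rw [h p hp] at ht ⊢
    exact finalState_stuck π par f _ _ _ ht
  · rw [history_of_le π par f hR p hp] at ht
    exact absurd ht (Set.notMem_empty t')

lemma HistoryUpTo.disseminatedIn (hR : R.Valid) {t : ℕ} (h : HistoryUpTo π par f R t)
    {p : ℕ × Fin k} {t₀ : ℕ} (ht : t₀ < t) (hr : R.release p = t₀) :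
    (R.execution π f).disseminatedIn ((R.execution π f).history π par t) p t₀ =
      (R.behaviour (reaction π par f) p.1 p.2).1 := by
  have hp : p.1 ≤ t₀ := by
    have := (hR (p.1 + 1)).le_release p p.1.lt_succ_self
    rw [hr] at this
    exact_mod_cast this
  rw [← h.log_self (by omega : p.1 < t), Execution.disseminatedIn]
  split_ifs with hact
  · ext m
    simp only [Finset.mem_biUnion, Finset.mem_range, Finset.mem_filter]
    constructor
    · rintro ⟨t₁, -, hm, -⟩
      by_cases h1 : t₁ = p.1
      · rwa [← h1]
      · rw [h.log_of_ne hR p h1] at hm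
        exact absurd hm (Finset.notMem_empty m)
    · exact fun hm => ⟨p.1, by omega, hm, by simp [execution, hr]⟩
  -- The only obstacle to dissemination is being stuck, and then the log is empty as well.
  · symm
    simp only [Execution.activeIn, not_and, not_not] at hact
    by_cases hs : ∃ t₁, t₁ ∈ ((R.execution π f).history π par t p).stuckAt
    · obtain ⟨t₁, h1⟩ := hs
      exact (h.stuck hR h1).2 _
    · exact absurd (hact ⟨(mem_allocated π f hR).2 (Or.inr hr),
        fun t₁ _ h1 => hs ⟨t₁, h1⟩⟩) (fun h1 => hs ⟨_, h1⟩)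

lemma HistoryUpTo.mem_disseminatedIn (hR : R.Valid) {t : ℕ} (h : HistoryUpTo π par f R t)
    {p : ℕ × Fin k} {t₀ : ℕ} {m : Msg Id Data Tx O} (ht : t₀ < t)
    (hm : m ∈ (R.execution π f).disseminatedIn ((R.execution π f).history π par t) p t₀) :
    R.release p = t₀ ∧ p.1 ≤ t₀ ∧ m ∈ (R.behaviour (reaction π par f) p.1 p.2).1 := by
  rw [Execution.disseminatedIn] at hm
  split_ifs at hm with hact
  · simp only [Finset.mem_biUnion, Finset.mem_range, Finset.mem_filter] at hm
    obtain ⟨t₁, h1, hm, hr⟩ := hm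
    by_cases h2 : t₁ = p.1
    · subst h2
      rw [h.log_self (by omega)] at hm
      exact ⟨by simpa [execution] using hr, by omega, hm⟩
    · rw [h.log_of_ne hR p h2] at hm
      exact absurd hm (Finset.notMem_empty m)
  · exact absurd hm (Finset.notMem_empty m)

lemma execution_timing {p q : ℕ × Fin k} (m : Msg Id Data Tx O) {t : ℕ} (ht : t < q.1)
    (hp : p.1 ≤ t) :
    ((R.execution π f).timing p q m t = some q.1) ↔ p ∈ R.hears q := by
  have hpq : p ≠ q := by rintro rfl; omega
  by_cases h : p ∈ R.hears q
  · simp [execution, hpq, ht, h]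
  · simp only [execution, hpq, if_false, ht, true_and, h, iff_false]
    split_ifs with h'
    · obtain ⟨r, h1, h2, -⟩ := h'
      rw [h1]
      simp only [ENat.toNat_natCast, Option.some.injEq]
      omega
    · simp

lemma HistoryUpTo.receivedIn (hR : R.Valid) {q : ℕ × Fin k} (h : HistoryUpTo π par f R q.1) :
    (R.execution π f).receivedIn ((R.execution π f).history π par q.1) q q.1 =
      R.inbox (reaction π par f) q := by
  classical
  rw [Execution.receivedIn, if_pos (activeIn_history_self π par f hR q)]
  have henv : ((R.execution π f).env q q.1) = ∅ := rfl
  rw [henv, Finset.empty_val, Multiset.map_zero, add_zero, inbox]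
  set B : ℕ × Fin k → Multiset (Msg Id Data Tx O) :=
    fun p => (R.behaviour (reaction π par f) p.1 p.2).1.val with hB
  have hsum : ∀ t₀ ∈ Finset.range q.1, (∑ p ∈ (R.execution π f).allocated t₀,
      (((R.execution π f).disseminatedIn ((R.execution π f).history π par q.1) p t₀).filter
        fun m => (R.execution π f).timing p q m t₀ = some q.1).val) =
      ∑ p ∈ Finset.range q.1 ×ˢ Finset.univ,
        if p ∈ R.hears q ∧ R.release p = t₀ then B p else 0 := by
    intro t₀ ht₀
    rw [Finset.mem_range] at ht₀
    have hsub : (R.execution π f).allocated t₀ ⊆ Finset.range q.1 ×ˢ Finset.univ := by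
      intro p hp
      have := (Finset.mem_filter.1 hp).1
      simp only [Finset.mem_product, Finset.mem_range, Finset.mem_univ, and_true] at this ⊢
      omega
    rw [← Finset.sum_subset hsub (fun p _ hp => if_neg fun hc =>
      hp ((mem_allocated π f hR).2 (Or.inr hc.2)))]
    refine Finset.sum_congr rfl fun p _ => ?_
    split_ifs with hc
    · rw [h.disseminatedIn hR ht₀ hc.2, Finset.filter_true_of_mem]
      intro m _
      refine (execution_timing m ht₀ ?_).2 hc.1
      have := (hR (p.1 + 1)).le_release p p.1.lt_succ_self
      rw [hc.2] at this
      exact_mod_cast this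
    · rw [Finset.filter_false_of_mem]
      · rfl
      · intro m hm ht
        obtain ⟨h1, h2, -⟩ := h.mem_disseminatedIn hR ht₀ hm
        exact hc ⟨(execution_timing m ht₀ h2).1 ht, h1⟩
  -- Each sender has a single release date, and a sender heard by `q` has it before `q.1`, so the
  -- sum over dates collapses.
  have hgoal : (∑ t₀ ∈ Finset.range q.1, ∑ p ∈ Finset.range q.1 ×ˢ Finset.univ,
      if p ∈ R.hears q ∧ R.release p = t₀ then B p else 0) =
      ∑ p ∈ Finset.range q.1 ×ˢ (Finset.univ : Finset (Fin k)),
        if p ∈ R.hears q then B p else 0 := by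
    rw [Finset.sum_comm]
    refine Finset.sum_congr rfl fun p _ => ?_
    by_cases hp : p ∈ R.hears q
    · have hlt := ((hR (q.1 + 1)).released q p q.1.lt_succ_self hp).2
      obtain ⟨r, hr⟩ := ENat.ne_top_iff_exists.1 (ne_top_of_lt hlt)
      rw [← hr] at hlt ⊢
      rw [Finset.sum_eq_single r]
      · simp [hp]
      · intro r' _ hne
        refine if_neg fun hc => hne ?_
        exact_mod_cast hc.2.symm
      · intro hc
        exact absurd (Finset.mem_range.2 (by exact_mod_cast hlt)) hc
    · simp [hp]
  rw [← hgoal, ← Finset.sum_congr rfl hsum]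

variable (π par f)

/-- After its own timeslot a player can be active only to release late messages; it has halted by
then, so its state is frozen. -/
lemma historyUpTo (hR : R.Valid) (t : ℕ) : HistoryUpTo π par f R t := by
  induction t with
  | zero => exact fun p hp => absurd hp (Nat.not_lt_zero _)
  | succ t ih =>
    intro p hp
    rw [Execution.history]
    beta_reduce
    rcases (Nat.lt_succ_iff.1 hp).lt_or_eq with hpt | rfl
    · rw [← ih p hpt]
      refine if_neg ?_
      rintro ⟨⟨h, -⟩, hh⟩
      have hne : p.1 ≠ t := hpt.ne
      have hrel := ((mem_allocated π f hR).1 h).resolve_left hne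
      have hl : R.Late p := by
        rw [Late, hrel]
        exact_mod_cast hne.symm
      simp only [execution, hl, if_true] at hh
      have : t < p.1 + 1 := by exact_mod_cast hh
      omega
    · rw [if_pos, ih.receivedIn hR, history_of_le π par f hR p le_rfl, finalState]
      · congr 1
        simp [execution]
      · refine ⟨activeIn_history_self π par f hR p, ?_⟩
        simp only [execution]
        split_ifs
        · exact_mod_cast p.1.lt_succ_self
        · exact ENat.natCast_lt_top _

lemma history_of_lt (hR : R.Valid) {p : ℕ × Fin k} {t : ℕ} (ht : p.1 < t) :
    (R.execution π f).history π par t p =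
      finalState π par f p (R.input p) (R.inbox (reaction π par f) p) :=
  historyUpTo π par f hR t p ht

lemma active_self (hR : R.Valid) (p : ℕ × Fin k) : (R.execution π f).Active π par p.1 p :=
  activeIn_history_self π par f hR p

lemma Valid.eq_fst_of_active (hR : R.Valid) {p : ℕ × Fin k} {t : ℕ} (hp : ¬ R.Late p)
    (h : (R.execution π f).Active π par t p) : t = p.1 := by
  rcases (mem_allocated π f hR).1 h.1 with h | h
  · exact h.symm
  · rw [Late, not_not, h] at hp
    exact_mod_cast hp

lemma outputsAt_iff (hR : R.Valid) {p : ℕ × Fin k} (hp : ¬ R.Late p) (t : ℕ) (b : Bool) :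
    (R.execution π f).OutputsAt π par p t b ↔
      t = p.1 ∧ (R.behaviour (reaction π par f) p.1 p.2).2 = some b := by
  have hb : (R.behaviour (reaction π par f) p.1 p.2).2 = some b ↔
      p.1 ∉ ((R.execution π f).history π par (p.1 + 1) p).stuckAt ∧
        π.diagram.output ((R.execution π f).history π par (p.1 + 1) p).state = some b := by
    rw [behaviour_eq_inbox, history_of_lt π par f hR p.1.lt_succ_self, reaction]
    split_ifs with h <;> simp [h]
  rw [hb]
  constructor
  · rintro ⟨h1, -, h2⟩
    obtain rfl := hR.eq_fst_of_active π par f hp h1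
    exact ⟨rfl, h2⟩
  · rintro ⟨rfl, h⟩
    refine ⟨active_self π par f hR p, ?_, h⟩
    simp [execution, hp]

/-! ### Consistency and bounds -/

/-- The environment sends nothing and players can only repeat transactions they have heard, so by
induction on time none ever appears. -/
lemma tx_notMem_behaviour (R : Schedule k) : ∀ p : ℕ × Fin k,
    ∀ m ∈ (R.behaviour (reaction π par f) p.1 p.2).1, ∀ a, Entry.tx a ∉ m := by
  suffices H : ∀ t i, ∀ m ∈ (R.behaviour (reaction π par f) t i).1, ∀ a, Entry.tx a ∉ m from
    fun p => H p.1 p.2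
  intro t
  induction t using Nat.strong_induction_on with
  | _ t ih =>
    intro i m hm a ha
    rw [behaviour_eq_inbox _ R (t, i)] at hm
    rcases tx_heard_of_mem_runSlot_log π par _ _ _ _ _ (by rfl) hm ha with h | ⟨m', hm', ha'⟩
    · exact absurd h (Set.notMem_empty _)
    · rw [inbox, Multiset.mem_sum] at hm'
      obtain ⟨p, hp, hm'⟩ := hm'
      split_ifs at hm'
      · simp only [Finset.mem_product, Finset.mem_range] at hp
        exact ih p.1 hp.1 p.2 m' hm' a ha'
      · exact absurd hm' (Multiset.notMem_zero m')

lemma confirmed_eq_empty (hR : R.Valid) (p : ℕ × Fin k) (t : ℕ) :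
    (R.execution π f).confirmed π par p t = ∅ := by
  refine Set.eq_empty_of_forall_notMem fun a ha => ?_
  obtain ⟨t', -, hm⟩ := π.confirm_subset _ _ ha
  rw [Execution.received, Execution.receivedIn] at hm
  split_ifs at hm
  · rw [Multiset.mem_add, Multiset.mem_sum] at hm
    rcases hm with ⟨t₀, ht₀, hm⟩ | hm
    · rw [Multiset.mem_sum] at hm
      obtain ⟨q, -, hm⟩ := hm
      rw [Finset.mem_val, Finset.mem_filter] at hm
      have := (historyUpTo π par f hR t').mem_disseminatedIn hR (Finset.mem_range.1 ht₀) hm.1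
      exact tx_notMem_behaviour π par f R q _ this.2.2 a (by simp)
    · simp [execution] at hm
  · simp at hm

lemma synchronous (hR : R.Valid) (hΔ : 2 ≤ par.delay) :
    (R.execution π f).Synchronous π par := by
  refine ⟨fun p q m t r h => ?_, fun p m t => by simp [execution],
    fun p q m t t' hpq hm ht hact => ?_⟩
  · simp only [execution] at h
    split_ifs at h with h1 h2 h3
    · cases h; omega
    · cases h; exact h2.1
    · obtain ⟨r', h4, h5, h6⟩ := h3
      rw [h4] at h
      cases h
      simpa using h6
  · obtain ⟨hr, hp, -⟩ :=
      (historyUpTo π par f hR (t + 1)).mem_disseminatedIn hR t.lt_succ_self hm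
    have hactself := active_self π par f hR q
    rcases (mem_allocated π f hR).1 hact.1 with hq | hq
    · subst hq
      refine ⟨q.1, le_rfl, (execution_timing m (by omega) hp).2 ?_, hactself⟩
      refine (hR (q.1 + 1)).hears q p q.1.lt_succ_self (by omega) ?_
      rw [hr]
      exact_mod_cast (by omega : t + 2 ≤ q.1)
    -- Here `q` is back to release its messages: it receives what it did not hear at its own
    -- timeslot now.
    · have hq' : q.1 ≤ t' := by
        have := (hR (q.1 + 1)).le_release q q.1.lt_succ_self
        rw [hq] at this
        exact_mod_cast this
      by_cases h1 : t < q.1 ∧ p ∈ R.hears q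
      · exact ⟨q.1, hq', (execution_timing m h1.1 hp).2 h1.2, hactself⟩
      · refine ⟨t', le_rfl, ?_, hact⟩
        simp only [execution, hpq, if_false, h1]
        rcases hq'.lt_or_eq with h2 | h2
        · rw [if_pos ⟨t', hq, h2, by omega⟩, hq]
          rfl
        · refine absurd ⟨by omega, ?_⟩ h1
          refine (hR (q.1 + 1)).hears q p q.1.lt_succ_self (by omega) ?_
          rw [hr]
          exact_mod_cast (by omega : t + 2 ≤ q.1)

lemma consistent (hR : R.Valid) (hf : Function.Injective f) (hk : 0 < k) (hΔ : 2 ≤ par.delay) :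
    (R.execution π f).Consistent π par where
  ids_nonempty p := Set.singleton_nonempty _
  ids_disjoint p q hpq := by
    simpa [execution] using fun h => hpq (hf h)
  exists_active t := ⟨(t, ⟨0, hk⟩), active_self π par f hR (t, ⟨0, hk⟩)⟩
  honest_halt p hp := if_neg hp
  honest_release p hp t m := by
    have hp' : R.release p = p.1 := not_not.1 hp
    simp only [execution]
    split_ifs with h
    · rw [hp', h]
    · rfl
  le_release p t m := by
    simp only [execution]
    split_ifs with h
    · rw [h]; exact (hR (p.1 + 1)).le_release p p.1.lt_succ_self
    · exact le_rfl
  synchronous := synchronous π par f hR hΔ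
  env_active p t h := by simp [execution] at h
  balance_inactive o p t h := by
    refine if_neg ?_
    rintro rfl
    exact h (active_self π par f hR p)
  balance_ordinary o p t h := by
    simp [execution, unitBalance, h]

/-- Only the group of the current timeslot holds resources, `k` units in all, with at most one of
them in Byzantine hands; reactivated players hold none. All stakes of the players vanish. -/
lemma bounded (hR : R.Valid) {ρ : ℝ} (hk : 0 < k) (hρ : 1 ≤ ρ * k) (hRmax : ∀ o, k ≤ par.Rmax o)
    (hf : ∀ p, f p ∉ par.stake₀.support) : (R.execution π f).Bounded π par ρ where
  resource o ho t := by
    classical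
    have hbal : ∀ p, (R.execution π f).balance o p t = if p.1 = t then 1 else 0 := fun p => by
      simp [execution, unitBalance, ho]
    have hinj : Function.Injective (fun i : Fin k => (t, i)) := fun i j h => by simpa using h
    have hfilter : ((R.execution π f).allocated t).filter (fun p => p.1 = t) =
        Finset.univ.map ⟨fun i : Fin k => (t, i), hinj⟩ := by
      ext p
      simp only [Finset.mem_filter, mem_allocated π f hR, Finset.mem_map, Finset.mem_univ,
        true_and, Function.Embedding.coeFn_mk]
      constructor
      · rintro ⟨-, rfl⟩
        exact ⟨p.2, rfl⟩
      · rintro ⟨i, rfl⟩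
        exact ⟨Or.inl rfl, rfl⟩
    have htotal : ∑ p ∈ (R.execution π f).allocated t, (R.execution π f).balance o p t = k := by
      simp only [hbal, Finset.sum_boole, hfilter]
      simp
    rw [htotal]
    refine ⟨hk, hRmax o, le_trans ?_ hρ⟩
    simp only [hbal, Finset.sum_boole, Nat.cast_id, Finset.filter_filter]
    rw [← Nat.cast_one, Nat.cast_le, Finset.card_le_one]
    intro p hp q hq
    simp only [Finset.mem_filter] at hp hq
    exact (hR (p.1 + 1)).late_unique p q p.1.lt_succ_self (hp.2.2.trans hq.2.2.symm) hp.2.1 hq.2.1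
  stake p _ t := by
    classical
    rw [confirmed_eq_empty π par f hR, pay.stake_empty]
    have h0 : ∀ A, (R.execution π f).activeStake π par par.stake₀ A t = 0 := fun A => by
      unfold Execution.activeStake
      refine Finset.sum_eq_zero fun i hi => ?_
      rw [Finset.mem_filter] at hi
      obtain ⟨h1, q, -, -, h2⟩ := hi
      rw [show i = f q from h2] at h1
      exact absurd h1 (hf q)
    simp [h0]

end Schedule

end Permissionless

/-! ### Choice of the group size and the identifiers. -/

open Permissionless in
theorem theorem5p1 {Id Data Tx O : Type*} [Infinite Id] [Finite O] {pay : PaymentSystem Id Tx}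
    (π : Protocol Id Data Tx O pay) (ρ : ℝ) (hρ : 0 < ρ) (Δ : ℕ) (hΔ : 2 ≤ Δ) (S₀ : Id →₀ ℕ) :
    (SafeBA π ρ Δ S₀ → HasNonterminatingExecution π ρ Δ S₀) ∧ ¬ SolvesBA π ρ Δ S₀ := by
  have main : SafeBA π ρ Δ S₀ → HasNonterminatingExecution π ρ Δ S₀ := by
    intro hsafe
    obtain ⟨k, hk2, hkρ⟩ : ∃ k : ℕ, 2 ≤ k ∧ 1 ≤ ρ * k := by
      obtain ⟨n, hn⟩ := exists_nat_ge (1 / ρ)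
      -- `n ≥ 1 / ρ` keeps one Byzantine unit within the bound; adding 2 ensures an honest player in
      -- every group.
      refine ⟨n + 2, by omega, ?_⟩
      rw [div_le_iff₀ hρ] at hn
      push_cast
      nlinarith
    have hk : 0 < k := by omega
    -- Identifiers without initial stake make the stake condition trivial.
    have : Infinite {i : Id // i ∉ S₀.support} :=
      (Set.Finite.infinite_compl S₀.support.finite_toSet).to_subtype
    obtain ⟨g, hg⟩ : ∃ g : ℕ × Fin k → {i : Id // i ∉ S₀.support}, Function.Injective g :=
      ⟨fun p => Infinite.natEmbedding _ (Encodable.encode p),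
        fun p q h => Encodable.encode_injective ((Infinite.natEmbedding _).injective h)⟩
    let f : ℕ × Fin k → Id := fun p => (g p).1
    have hf : Function.Injective f := Subtype.val_injective.comp hg
    let par : Params Id O := ⟨Δ, fun _ => k, S₀⟩
    have hcons : ∀ R : Schedule k, R.Valid → (R.execution π f).Consistent π par :=
      fun R hR => Schedule.consistent π par f hR hf hk hΔ
    have hbd : ∀ R : Schedule k, R.Valid → (R.execution π f).Bounded π par ρ :=
      fun R hR => Schedule.bounded π par f hR hk hkρ (fun _ => le_rfl) (fun p => (g p).2)
    have hAV := fun R hR => hsafe (fun _ => k) (fun _ => hk) _ _ (hcons R hR) (hbd R hR)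
    have hout : ∀ R : Schedule k, R.Valid → ∀ b, R.Decides (Schedule.reaction π par f) b →
        ∃ p, ∃ _ : ¬ R.Late p, (R.execution π f).OutputsAt π par p p.1 b := by
      rintro R hR b ⟨p, hp, hb⟩
      exact ⟨p, hp, (Schedule.outputsAt_iff π par f hR hp _ _).2 ⟨rfl, hb⟩⟩
    obtain ⟨R, hR, hnone⟩ := Schedule.exists_valid_undecided (F := Schedule.reaction π par f)
      (fun R hR b b' h h' => by
        obtain ⟨p, hp, hpb⟩ := hout R hR b h
        obtain ⟨q, hq, hqb⟩ := hout R hR b' h'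
        exact (hAV R hR).1 p hp q hq _ _ _ _ hpb hqb)
      (fun R hR b hb b' h' => by
        obtain ⟨p, hp, hpb⟩ := hout R hR b' h'
        exact (hAV R hR).2 b hb p hp _ _ hpb)
    refine ⟨fun _ => k, fun _ => hk, _, R.execution π f, hcons R hR, hbd R hR, fun t => ?_,
      fun p hp t b h => hnone b ⟨p, hp, ((Schedule.outputsAt_iff π par f hR hp _ _).1 h).2⟩⟩
    -- A group has two distinct players, and they cannot both be late.
    by_contra! hall
    have key : ∀ i : Fin k, R.Late (t, i) := fun i => by
      by_contra hi
      exact hall (t, i) hi (Schedule.active_self π par f hR (t, i))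
    have := (hR (t + 1)).late_unique (t, ⟨0, hk⟩) (t, ⟨1, by omega⟩) t.lt_succ_self rfl
      (key _) (key _)
    simp at this
  refine ⟨main, fun hsolve => ?_⟩
  obtain ⟨Rmax, hRmax, P, E, hc, hb, hact, hno⟩ := main fun Rmax hR P E hc hb => by
    obtain ⟨-, -, h⟩ := hsolve Rmax hR P E hc hb
    exact h
  obtain ⟨t', hterm, -⟩ := hsolve Rmax hRmax P E hc hb
  obtain ⟨p, hp, hpa⟩ := hact t'
  obtain ⟨t, b, h⟩ := hterm p hp ⟨t', le_rfl, hpa⟩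
  exact hno p hp t b h
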